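/- Let $\pi : Y \to X$ be a smooth fibre bundle with $\dim X = n$ and $\dim Y = n+m$, let $r \ge 0$ and $2 \le q \le n$, and let $J^rY$ be the bundle of $r$-jets $j^r_x\gamma$ of local smooth sections $\gamma$ of $\pi$. An adapted chart $(V,\psi)$, $\psi=(x^i,y^\sigma)$, is a chart of $Y$ such that $(x^i)$ is a chart of $X$ on $\pi(V)$ and $\pi(x^i,y^\sigma)=(x^i)$. It induces on the set $V^r\subset J^rY$ of jets with target in $V$ the coordinates $x^i$, $y^\sigma_J$ ($|J|\le r$), where $J=\{j_1,\dots,j_k\}$ runs over unordered multi-indices with entries in $\{1,\dots,n\}$ and $y^\sigma_J(j^r_x\gamma)=\partial^k (y^\sigma\circ\gamma)/\partial x^{j_1}\cdots\partial x^{j_k}$ at $x$. Put $$\omega^\sigma_J = dy^\sigma_J - \sum_{i} y^\sigma_{iJ}\,dx^i ,\qquad |J|\le r-1 .$$ A smooth $q$-form $\rho$ on $J^rY$ (or on $V^r$) is called contact if $(j^r\gamma)^*\rho=0$ for every smooth section $\gamma$ of $\pi$ over an open subset of $X$ (in the case of $V^r$: for every such section with values in $V$). (a) Let $(V,\psi)$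 be an adapted chart and $\rho$ a smooth $q$-form on $V^r$. Then $\rho$ is contact if and only if on $V^r$ $$\rho=\sum_{\sigma}\sum_{|J|\le r-1}\omega^\sigma_J\wedge\Phi^J_\sigma+\sum_{\sigma}\sum_{|I|=r-1}d\omega^\sigma_I\wedge\Psi^I_\sigma \qquad (*)$$ for some smooth forms $\Phi^J_\sigma$ of degree $q-1$ and $\Psi^I_\sigma$ of degree $q-2$ on $V^r$; here the forms $\Phi^J_\sigma$, $\Psi^I_\sigma$ can be arbitrary, i.e. every smooth $\rho$ of the form $(*)$ is contact. (For $r=0$ both sums are empty.) (b) A smooth $q$-form $\rho$ on $J^rY$ is contact if and only if its restriction to $V^r$ has an expression $(*)$ for every adapted chart $(V,\psi)$. -/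

import Mathlib

open Set
open scoped Manifold ContDiff Topology

noncomputable section

namespace JetContact

/-! ### Wedge product of (constant) alternating forms -/

section Wedge

variable {E : Type*} [NormedAddCommGroup E] [NormedSpace ℝ E]

/-- The product of two alternating forms obtained from the shuffle product `domCoprod`, by
multiplying the real values. -/
def sumWedge {p l : ℕ} (α : E [⋀^Fin p]→L[ℝ] ℝ) (β : E [⋀^Fin l]→L[ℝ] ℝ) :
    E [⋀^(Fin p ⊕ Fin l)]→ₗ[ℝ] ℝ :=
  (LinearMap.mul' ℝ ℝ).compAlternatingMap
    (AlternatingMap.domCoprod α.toAlternatingMap β.toAlternatingMap)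

theorem continuous_sumWedge {p l : ℕ} (α : E [⋀^Fin p]→L[ℝ] ℝ) (β : E [⋀^Fin l]→L[ℝ] ℝ) :
    Continuous (fun v : Fin p ⊕ Fin l → E => sumWedge α β v) := by
  have h : (fun v : Fin p ⊕ Fin l → E => sumWedge α β v) =
      fun v => ∑ s : Equiv.Perm.ModSumCongr (Fin p) (Fin l),
        LinearMap.mul' ℝ ℝ
          (AlternatingMap.domCoprod.summand α.toAlternatingMap β.toAlternatingMap s v) := by
    funext v
    simp only [sumWedge, LinearMap.compAlternatingMap_apply, AlternatingMap.domCoprod_apply,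
      sum_apply, map_sum]
  rw [h]
  refine continuous_finsetSum _ fun s _ => ?_
  induction s using Quotient.inductionOn' with
  | _ s =>
    simp only [AlternatingMap.domCoprod.summand_mk'', smul_apply,
      MultilinearMap.domDomCongr_apply, MultilinearMap.domCoprod_apply]
    have h2 : Continuous fun v : Fin p ⊕ Fin l → E =>
        (α fun i => v (s (Sum.inl i))) * (β fun i => v (s (Sum.inr i))) :=
      (α.cont.comp (continuous_pi fun i => continuous_apply _)).mul
        (β.cont.comp (continuous_pi fun i => continuous_apply _))
    rcases Int.units_eq_one_or (Equiv.Perm.sign s) with h3 | h3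
    · simpa [h3] using h2
    · simp only [h3, Units.neg_smul, one_smul]
      simpa using h2.fun_neg

/-- The wedge product of a `p`-form and an `l`-form, as a form of degree `k = p + l`. -/
def wedge {p l k : ℕ} (h : p + l = k) (α : E [⋀^Fin p]→L[ℝ] ℝ) (β : E [⋀^Fin l]→L[ℝ] ℝ) :
    E [⋀^Fin k]→L[ℝ] ℝ :=
  { (sumWedge α β).domDomCongr (finSumFinEquiv.trans (finCongr h)) with
    cont := by
      exact (continuous_sumWedge α β).comp
        (continuous_pi fun i =>
          continuous_apply ((finSumFinEquiv.trans (finCongr h)) i)) }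

end Wedge

/-! ### Multi-indices and the coordinate space of the jet bundle -/

/-- Unordered multi-indices `{j₁, …, jₖ}`, `jᵢ ∈ {1, …, n}`, of length `k < N`. -/
abbrev MultiIndex (n N : ℕ) : Type := {J : Multiset (Fin n) // Multiset.card J < N}

theorem finite_multiIndex (n N : ℕ) : Finite (MultiIndex n N) := by
  refine Finite.of_injective
    (fun (J : MultiIndex n N) (i : Fin n) =>
      (⟨J.1.count i, lt_of_le_of_lt (Multiset.count_le_card i J.1) J.2⟩ : Fin N)) ?_
  intro J K h
  apply Subtype.ext
  ext i
  have := congrFun h i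
  simpa using this

instance (n N : ℕ) : Fintype (MultiIndex n N) :=
  @Fintype.ofFinite _ (finite_multiIndex n N)

/-- A multi-index of length `< N`, regarded as one of length `< N + 1`. -/
def MultiIndex.incl {n N : ℕ} (J : MultiIndex n N) : MultiIndex n (N + 1) :=
  ⟨J.1, Nat.lt_succ_of_lt J.2⟩

/-- The multi-index `iJ`. -/
def MultiIndex.cons {n N : ℕ} (i : Fin n) (J : MultiIndex n N) : MultiIndex n (N + 1) :=
  ⟨i ::ₘ J.1, by simpa using J.2⟩

/-- The empty multi-index. -/
def MultiIndex.nil {n N : ℕ} : MultiIndex n (N + 1) := ⟨0, by simp⟩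

/-- The space of coordinates `(xⁱ, y^σ_J)`, `|J| ≤ r`; here `y^σ` is the coordinate with empty
multi-index. -/
abbrev JetCoord (n m r : ℕ) : Type := (Fin n → ℝ) × (Fin m → MultiIndex n (r + 1) → ℝ)

/-- The partial derivative `∂^k g / ∂x^{j₁} ⋯ ∂x^{jₖ}` at `z`, where `J = {j₁, …, jₖ}`. -/
def partialDeriv {n : ℕ} (J : Multiset (Fin n)) (g : (Fin n → ℝ) → ℝ) (z : Fin n → ℝ) : ℝ :=
  iteratedFDeriv ℝ (J.sort).length g z (fun l => Pi.single ((J.sort).get l) (1 : ℝ))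

/-! ### Fibre bundles, adapted charts, sections -/

section Bundle

variable {n m : ℕ}
  {X : Type*} [TopologicalSpace X] [ChartedSpace (Fin n → ℝ) X]
  {Y : Type*} [TopologicalSpace Y] [ChartedSpace ((Fin n → ℝ) × (Fin m → ℝ)) Y]

variable (n m) in
/-- `π : Y → X` is a smooth fibre bundle with typical fibre `F`: a smooth surjection which has
smooth local trivializations over neighbourhoods of all points of the base. -/
structure IsSmoothFibreBundle (F : Type*) [TopologicalSpace F] [ChartedSpace (Fin m → ℝ) F]
    (π : Y → X) : Prop where
  smooth : ContMDiff 𝓘(ℝ, (Fin n → ℝ) × (Fin m → ℝ)) 𝓘(ℝ, Fin n → ℝ) ∞ π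
  surjective : Function.Surjective π
  locally_trivial : ∀ x : X, ∃ e : Bundle.Trivialization F π, x ∈ e.baseSet ∧
    ContMDiffOn 𝓘(ℝ, (Fin n → ℝ) × (Fin m → ℝ))
      (𝓘(ℝ, Fin n → ℝ).prod 𝓘(ℝ, Fin m → ℝ)) ∞
      e.toOpenPartialHomeomorph e.source ∧
    ContMDiffOn (𝓘(ℝ, Fin n → ℝ).prod 𝓘(ℝ, Fin m → ℝ))
      𝓘(ℝ, (Fin n → ℝ) × (Fin m → ℝ)) ∞
      e.toOpenPartialHomeomorph.symm e.target

variable (n m) in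
/-- An adapted chart `(V, ψ)`, `ψ = (xⁱ, y^σ)`: a chart `total` of `Y` with domain `V`, together
with a chart `base` of `X` with domain `π(V)`, in which `π` reads `(xⁱ, y^σ) ↦ (xⁱ)`. -/
structure AdaptedChart (π : Y → X) where
  base : OpenPartialHomeomorph X (Fin n → ℝ)
  total : OpenPartialHomeomorph Y ((Fin n → ℝ) × (Fin m → ℝ))
  base_mem : base ∈ IsManifold.maximalAtlas 𝓘(ℝ, Fin n → ℝ) ∞ X
  total_mem : total ∈ IsManifold.maximalAtlas 𝓘(ℝ, (Fin n → ℝ) × (Fin m → ℝ)) ∞ Y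
  base_source : base.source = π '' total.source
  proj_eq : ∀ y ∈ total.source, (total y).1 = base (π y)

variable (n m) in
/-- A smooth section `γ : U → Y` of `π` over an open subset `U` of `X` (the values of the function
outside `U` play no role). -/
structure LocalSection (π : Y → X) where
  domain : Set X
  isOpen_domain : IsOpen domain
  toFun : X → Y
  smooth : ContMDiffOn 𝓘(ℝ, Fin n → ℝ) 𝓘(ℝ, (Fin n → ℝ) × (Fin m → ℝ)) ∞ toFun domain
  section_eq : ∀ x ∈ domain, π (toFun x) = x

variable {π : Y → X}

/-- The map `z ↦ (z, (∂^J (y^σ ∘ γ ∘ φ⁻¹))(z))_{|J| ≤ r}`, which is the expression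
`ψʳ ∘ jʳγ ∘ φ⁻¹` of the `r`-extension of `γ` in the chart associated with `c = (V, ψ)`. -/
def AdaptedChart.prolong (c : AdaptedChart n m π) (r : ℕ) (γ : LocalSection n m π) (z : Fin n → ℝ) :
    JetCoord n m r :=
  (z, fun σ J => partialDeriv J.1 (fun w => (c.total (γ.toFun (c.base.symm w))).2 σ) z)

/-! ### Jets -/

variable (n m) in
/-- A section together with a point `x` of its domain. -/
structure PointedSection (π : Y → X) extends LocalSection n m π where
  point : X
  point_mem : point ∈ domain

variable (n m) in
/-- Two sections at `x` have the same `r`-jet if they have the same value `y` and, in the adapted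
charts at `y`, the same partial derivatives up to order `r`. (This does not depend on the
adapted chart.) -/
def jetSetoid (π : Y → X) (r : ℕ) : Setoid (PointedSection n m π) where
  r s t := s.point = t.point ∧ s.toFun s.point = t.toFun t.point ∧
    ∀ c : AdaptedChart n m π, s.toFun s.point ∈ c.total.source →
      c.prolong r s.toLocalSection (c.base s.point) = c.prolong r t.toLocalSection (c.base t.point)
  iseqv :=
    { refl := fun _ => ⟨rfl, rfl, fun _ _ => rfl⟩
      symm := fun ⟨h1, h2, h3⟩ => ⟨h1.symm, h2.symm, fun c hc => (h3 c (h2 ▸ hc)).symm⟩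
      trans := fun ⟨h1, h2, h3⟩ ⟨k1, k2, k3⟩ =>
        ⟨h1.trans k1, h2.trans k2, fun c hc => (h3 c hc).trans (k3 c (h2 ▸ hc))⟩ }

variable (n m) in
/-- The set `JʳY` of `r`-jets of sections of `π`. -/
def JetSpace (π : Y → X) (r : ℕ) : Type _ := Quotient (jetSetoid n m π r)

/-- The jet `jʳₓγ`. -/
def LocalSection.jet (γ : LocalSection n m π) (r : ℕ) (x : X) (hx : x ∈ γ.domain) : JetSpace n m π r :=
  Quotient.mk (jetSetoid n m π r) ⟨γ, x, hx⟩

/-- The projection `JʳY → Y`, `jʳₓγ ↦ γ(x)`. -/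
def JetSpace.target {r : ℕ} (j : JetSpace n m π r) : Y :=
  Quotient.lift (s := jetSetoid n m π r) (fun s : PointedSection n m π => s.toFun s.point)
    (fun _ _ h => h.2.1) j

/-- The domain `Vʳ` of the chart of `JʳY` associated with the adapted chart `c = (V, ψ)`. -/
def AdaptedChart.jetSource (c : AdaptedChart n m π) (r : ℕ) : Set (JetSpace n m π r) :=
  {j | j.target ∈ c.total.source}

open Classical in
/-- The associated chart map `ψʳ = (xⁱ, y^σ_J)_{|J| ≤ r}` on `Vʳ` (with value `0` outside
`Vʳ`). -/
def AdaptedChart.jetChart (c : AdaptedChart n m π) (r : ℕ) (j : JetSpace n m π r) : JetCoord n m r :=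
  Quotient.lift (s := jetSetoid n m π r)
    (fun s : PointedSection n m π =>
      if s.toFun s.point ∈ c.total.source then
        c.prolong r s.toLocalSection (c.base s.point) else 0)
    (fun s t h => by
      by_cases hs : s.toFun s.point ∈ c.total.source
      · simp only [if_pos hs, if_pos (h.2.1 ▸ hs), h.2.2 c hs]
      · simp only [if_neg hs, if_neg (h.2.1 ▸ hs)]) j

theorem AdaptedChart.jetChart_jet (c : AdaptedChart n m π) (r : ℕ) (γ : LocalSection n m π) (x : X)
    (hx : x ∈ γ.domain) (hc : γ.toFun x ∈ c.total.source) :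
    c.jetChart r (γ.jet r x hx) = c.prolong r γ (c.base x) :=
  if_pos hc

/-- The open set `ψʳ(Vʳ)`: the points `(xⁱ, y^σ_J)` such that `(xⁱ, y^σ) ∈ ψ(V)`. -/
def AdaptedChart.jetTarget (c : AdaptedChart n m π) (r : ℕ) : Set (JetCoord n m r) :=
  {p | (p.1, fun σ => p.2 σ MultiIndex.nil) ∈ c.total.target}

/-! ### Differential forms -/

/-- Differential forms on `Vʳ`, expressed in the coordinates `ψʳ`, i.e. on the open set
`ψʳ(Vʳ)` (values outside this set play no role, see `AdaptedChart.IsSmooth`). -/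
abbrev CoordForm (n m r q : ℕ) : Type :=
  JetCoord n m r → (JetCoord n m r) [⋀^Fin q]→L[ℝ] ℝ

/-- The form is smooth on `Vʳ`. -/
def AdaptedChart.IsSmooth (c : AdaptedChart n m π) {r q : ℕ} (ρ : CoordForm n m r q) : Prop :=
  ContDiffOn ℝ ∞ ρ (c.jetTarget r)

/-- `T` is the coordinate transformation `ψ'ʳ ∘ (ψʳ)⁻¹` on `ψʳ(Vʳ ∩ V'ʳ)`. -/
def IsJetTransition (c c' : AdaptedChart n m π) (r : ℕ) (T : JetCoord n m r → JetCoord n m r) :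
    Prop :=
  ∀ j ∈ c.jetSource r ∩ c'.jetSource r, T (c.jetChart r j) = c'.jetChart r j

variable (n m) in
/-- A smooth differential `q`-form on `JʳY`: its expressions in all associated charts, which are
related by pull-back along the coordinate transformations. -/
structure JetForm (π : Y → X) (r q : ℕ) where
  rep : AdaptedChart n m π → CoordForm n m r q
  smooth : ∀ c : AdaptedChart n m π, c.IsSmooth (rep c)
  compatible : ∀ (c c' : AdaptedChart n m π) (T : JetCoord n m r → JetCoord n m r),
    IsJetTransition c c' r T → ∀ j ∈ c.jetSource r ∩ c'.jetSource r,
      rep c (c.jetChart r j) =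
        (rep c' (c'.jetChart r j)).compContinuousLinearMap (fderiv ℝ T (c.jetChart r j))

/-- The pull-back of a form along the `r`-extension of `γ`, at the point with coordinates `z`:
`(ψʳ ∘ jʳγ ∘ φ⁻¹)^* ρ`. -/
def AdaptedChart.pullback (c : AdaptedChart n m π) {r q : ℕ} (ρ : CoordForm n m r q)
    (γ : LocalSection n m π) (z : Fin n → ℝ) : (Fin n → ℝ) [⋀^Fin q]→L[ℝ] ℝ :=
  (ρ (c.prolong r γ z)).compContinuousLinearMap (fderiv ℝ (c.prolong r γ) z)

/-- A form on `Vʳ` is contact if `(jʳγ)^* ρ = 0` for all sections `γ` (wherever `γ` takes values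
in `V`, so that `jʳγ` takes values in `Vʳ`). -/
def AdaptedChart.IsContact (c : AdaptedChart n m π) {r q : ℕ} (ρ : CoordForm n m r q) : Prop :=
  ∀ (γ : LocalSection n m π), ∀ x ∈ γ.domain, γ.toFun x ∈ c.total.source →
    c.pullback ρ γ (c.base x) = 0

/-- A form on `JʳY` is contact if `(jʳγ)^* ρ = 0` for all sections `γ`. -/
def JetForm.IsContact {r q : ℕ} (ρ : JetForm n m π r q) : Prop :=
  ∀ (γ : LocalSection n m π), ∀ x ∈ γ.domain, ∀ c : AdaptedChart n m π, γ.toFun x ∈ c.total.source →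
    c.pullback (ρ.rep c) γ (c.base x) = 0

end Bundle

/-! ### The basic contact forms and the structure formula -/

section Structure

variable {n m r : ℕ}

/-- The linear functional `dxⁱ`. -/
def dx (i : Fin n) : JetCoord n m r →L[ℝ] ℝ :=
  (ContinuousLinearMap.proj (R := ℝ) (φ := fun _ : Fin n => ℝ) i).comp
    (ContinuousLinearMap.fst ℝ _ _)

/-- The linear functional `dy^σ_J`. -/
def dy (σ : Fin m) (J : MultiIndex n (r + 1)) : JetCoord n m r →L[ℝ] ℝ :=
  (ContinuousLinearMap.proj (R := ℝ) (φ := fun _ : MultiIndex n (r + 1) => ℝ) J).comp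
    ((ContinuousLinearMap.proj (R := ℝ) (φ := fun _ : Fin m => MultiIndex n (r + 1) → ℝ) σ).comp
      (ContinuousLinearMap.snd ℝ _ _))

/-- The contact 1-forms `ω^σ_J = dy^σ_J - y^σ_{iJ} dxⁱ`, `|J| ≤ r - 1`. -/
def omega (σ : Fin m) (J : MultiIndex n r) : CoordForm n m r 1 := fun p =>
  ContinuousAlternatingMap.ofSubsingleton ℝ (JetCoord n m r) ℝ (0 : Fin 1)
    (dy σ J.incl - ∑ i : Fin n, p.2 σ (J.cons i) • dx i)

variable {X : Type*} [TopologicalSpace X] [ChartedSpace (Fin n → ℝ) X]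
  {Y : Type*} [TopologicalSpace Y] [ChartedSpace ((Fin n → ℝ) × (Fin m → ℝ)) Y]
  {π : Y → X}

/-- On `Vʳ` the form is
`∑_{|J| ≤ r-1} ω^σ_J ∧ Φ^J_σ + ∑_{|I| = r-1} dω^σ_I ∧ Ψ^I_σ`
with smooth forms `Φ^J_σ`, `Ψ^I_σ` on `Vʳ` of degrees `q - 1` and `q - 2`. -/
def AdaptedChart.HasContactExpression (c : AdaptedChart n m π) {q : ℕ} (hq : 2 ≤ q)
    (ρ : CoordForm n m r q) : Prop :=
  ∃ (Φ : Fin m → MultiIndex n r → CoordForm n m r (q - 1))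
    (Ψ : Fin m → MultiIndex n r → CoordForm n m r (q - 2)),
    (∀ σ J, c.IsSmooth (Φ σ J)) ∧ (∀ σ I, c.IsSmooth (Ψ σ I)) ∧
    ∀ p ∈ c.jetTarget r,
      ρ p = (∑ σ : Fin m, ∑ J : MultiIndex n r,
              wedge (by omega : 1 + (q - 1) = q) (omega σ J p) (Φ σ J p)) +
            ∑ σ : Fin m, ∑ I : MultiIndex n r with Multiset.card I.1 + 1 = r,
              wedge (by omega : (1 + 1) + (q - 2) = q) (extDeriv (omega σ I) p) (Ψ σ I p)

end Structure

end JetContact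

end

/-!
The statement on `JʳY` follows from the one on a chart, so fix an adapted chart. By
`AdaptedChart.fderiv_prolong` and `AdaptedChart.exists_section`, the tangent spaces of prolonged
sections through a point `p` of the jet bundle are exactly the images, under the linear isomorphism
`totalLift p`, of the integral elements
`A_a(v) = (v, ∑ᵢ a^σ_{iJ} vⁱ (|J| = r))`, where the derivatives `a` of order `r + 1` are arbitrary:
Taylor polynomials realize all of them. The isomorphism pulls `ω^σ_J` back to `dy^σ_J` and fixes the
forms `dω^σ_I`, `|I| = r - 1`. Hence `ρ` is contact if and only if the constant coefficient form
`(totalLift p)^* ρ_p` is annihilated by all `A_a^*`, and `ρ` has the required expression at `p` if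
and only if this form is a value of the linear map
`contactSum (Φ, Ψ) = ∑ dy^σ_J ∧ Φ^J_σ + ∑ dω^σ_I ∧ Ψ^I_σ`. The values of `contactSum` are annihilated
by `A_a^*` because `a^σ_{ijI}` is symmetric in `i` and `j`. Conversely, once the forms annihilated by
all `A_a^*` are known to be values of `contactSum` (`exists_contactSum_eq`), smooth coefficients are
obtained by applying a right inverse of the fixed linear map `contactSum`.

The pointwise converse is a statement of multilinear algebra. Let `α` be of degree `q ≤ n` with
`A_a^* α = 0` for all `a`. Subtract its orthogonal projection to the range of `contactSum`, for the
inner product in which `∂/∂xⁱ` and `√(J!) ∂/∂y^σ_J` are orthonormal. Orthogonality means that the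
remainder, again called `α`, has no components along `∂/∂y^σ_J` with `|J| < r`, and that it is
trace free: its contraction with `∑ᵢ (I(i) + 1) ∂/∂xⁱ ∧ ∂/∂y^σ_{iI}` vanishes for `|I| = r - 1`.
It has to be shown that `α = 0` (`eq_zero_of_isTraceFree`).

For covectors `λ` on `ℝⁿ` let `u_λ = ∑_{|J| = r} λ^J ∂/∂y^σ_J`. These vectors span the directions
`|J| = r`, so it suffices that `F = ι(u_{λ₀}) ⋯ ι(u_{λ_{k-1}}) α`, restricted to horizontal
vectors, vanishes. Adding `λ^{r+1}` to `a` changes `A_a` by the shear `λ ⊗ u_λ`; expanding the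
pull-back by shears gives `λ_{k-1} ∧ ⋯ ∧ λ₀ ∧ F = 0`
(`covectorWedgeIter_contractIter_eq_zero`). Regard `F` as a form whose coefficients are polynomials
in `λ₀, …, λ_{k-1}`. Trace freeness says that `F` is divergence free with respect to each `λ_j`. The
polarization operators `λ_l · ∂/∂λ_j`, `l < j`, preserve all these properties, so by induction they
annihilate `F`, which is to say that `F` is a highest weight vector. The commutation relation of the
divergence and `λ_j ∧ ·` then shows that the divergence of `λ_j ∧ G` is a positive multiple of `G`,
where `G = λ_{j-1} ∧ ⋯ ∧ λ₀ ∧ F` and positivity is due to `q ≤ n`. Therefore the factors `λ_j` can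
be cancelled one after the other, and `F = 0` (`eq_zero_of_wedgeGenericIter_eq_zero`).
-/

noncomputable section

namespace JetContact

/-! ### Auxiliary facts on alternating maps -/

theorem alternatingMap_sum_apply {M N ι κ : Type*} [AddCommGroup M] [Module ℝ M] [AddCommGroup N]
    [Module ℝ N] (s : Finset κ) (f : κ → M [⋀^ι]→ₗ[ℝ] N) (v : ι → M) :
    (∑ k ∈ s, f k) v = ∑ k ∈ s, f k v := by
  classical
  induction s using Finset.induction_on with
  | empty => simp
  | insert a s ha ih => simp [Finset.sum_insert ha, ih]

section CovectorWedge

variable {M A : Type*} [AddCommGroup M] [Module ℝ M] [CommRing A] [Algebra ℝ A] {p : ℕ}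

/-- The exterior product `θ ∧ F` of a covector and an alternating form with values in an
`ℝ`-algebra. -/
def covectorWedge (θ : M →ₗ[ℝ] A) (F : M [⋀^Fin p]→ₗ[ℝ] A) : M [⋀^Fin (p + 1)]→ₗ[ℝ] A :=
  AlternatingMap.alternatizeUncurryFin
    { toFun := fun w => θ w • F
      map_add' := fun w w' => by rw [map_add, add_smul]
      map_smul' := fun c w => by
        ext v
        simp }

theorem covectorWedge_apply (θ : M →ₗ[ℝ] A) (F : M [⋀^Fin p]→ₗ[ℝ] A) (v : Fin (p + 1) → M) :
    covectorWedge θ F v = ∑ s : Fin (p + 1), (-1) ^ (s : ℕ) * (θ (v s) * F (s.removeNth v)) := by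
  simp only [covectorWedge, AlternatingMap.alternatizeUncurryFin_apply]
  refine Finset.sum_congr rfl fun s _ => ?_
  rw [zsmul_eq_mul]
  simp

theorem covectorWedge_add_left (θ θ' : M →ₗ[ℝ] A) (F : M [⋀^Fin p]→ₗ[ℝ] A) :
    covectorWedge (θ + θ') F = covectorWedge θ F + covectorWedge θ' F := by
  refine AlternatingMap.ext fun v => ?_
  simp only [covectorWedge_apply, AlternatingMap.add_apply, LinearMap.add_apply, add_mul, mul_add,
    Finset.sum_add_distrib]

theorem covectorWedge_add_right (θ : M →ₗ[ℝ] A) (F G : M [⋀^Fin p]→ₗ[ℝ] A) :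
    covectorWedge θ (F + G) = covectorWedge θ F + covectorWedge θ G := by
  refine AlternatingMap.ext fun v => ?_
  simp only [covectorWedge_apply, AlternatingMap.add_apply, mul_add, Finset.sum_add_distrib]

@[simp]
theorem covectorWedge_zero_right (θ : M →ₗ[ℝ] A) :
    covectorWedge θ (0 : M [⋀^Fin p]→ₗ[ℝ] A) = 0 := by
  refine AlternatingMap.ext fun v => ?_
  simp [covectorWedge_apply]

theorem covectorWedge_self (θ : M →ₗ[ℝ] A) (F : M [⋀^Fin p]→ₗ[ℝ] A) :
    covectorWedge θ (covectorWedge θ F) = 0 := by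
  let f : M →ₗ[ℝ] M →ₗ[ℝ] M [⋀^Fin p]→ₗ[ℝ] A := LinearMap.mk₂ ℝ (fun v w => (θ v * θ w) • F)
    (fun v v' w => by rw [map_add, add_mul, add_smul])
    (fun c v w => by
      refine AlternatingMap.ext fun _ => ?_
      simp)
    (fun v w w' => by rw [map_add, mul_add, add_smul])
    (fun c v w => by
      refine AlternatingMap.ext fun _ => ?_
      simp)
  have h := AlternatingMap.alternatizeUncurryFin_alternatizeUncurryFinLM_comp_of_symmetric (f := f)
    (fun v w => by simp only [f, LinearMap.mk₂_apply, mul_comm])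
  rw [← h]
  refine AlternatingMap.ext fun v => ?_
  rw [covectorWedge_apply, AlternatingMap.alternatizeUncurryFin_apply]
  refine Finset.sum_congr rfl fun s _ => ?_
  rw [zsmul_eq_mul, covectorWedge_apply]
  simp [AlternatingMap.alternatizeUncurryFin_apply, f, Finset.mul_sum, mul_assoc, mul_left_comm]

theorem covectorWedge_comm (θ θ' : M →ₗ[ℝ] A) (F : M [⋀^Fin p]→ₗ[ℝ] A) :
    covectorWedge θ (covectorWedge θ' F) = -covectorWedge θ' (covectorWedge θ F) := by
  have h := covectorWedge_self (θ + θ') F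
  simp only [covectorWedge_add_left, covectorWedge_add_right, covectorWedge_self, zero_add,
    add_zero] at h
  exact eq_neg_of_add_eq_zero_right h

theorem vecCons_removeNth_succ {p : ℕ} {α : Type*} (a : α) (v : Fin (p + 1) → α)
    (s : Fin (p + 1)) :
    Fin.removeNth s.succ (Matrix.vecCons a v : Fin (p + 2) → α) =
      Matrix.vecCons a (s.removeNth v) := by
  funext k
  refine Fin.cases ?_ (fun k => ?_) k
  · simp [Fin.removeNth, Matrix.vecCons]
  · simp [Fin.removeNth, Matrix.vecCons]

theorem covectorWedge_vecCons (θ : M →ₗ[ℝ] A) (G : M [⋀^Fin (p + 1)]→ₗ[ℝ] A) (w : M)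
    (v : Fin (p + 1) → M) :
    covectorWedge θ G (Matrix.vecCons w v) = θ w * G v -
      ∑ s : Fin (p + 1), (-1) ^ (s : ℕ) *
        (θ (v s) * G (Matrix.vecCons w (s.removeNth v))) := by
  rw [covectorWedge_apply, Fin.sum_univ_succ]
  have : (Fin.removeNth 0 (Matrix.vecCons w v : Fin (p + 2) → M)) = v := by
    funext k; simp [Fin.removeNth]
  simp only [this, vecCons_removeNth_succ, Fin.val_zero, pow_zero, one_mul, Matrix.cons_val_zero,
    Matrix.cons_val_succ, Fin.val_succ, pow_succ, mul_neg, neg_mul, mul_one,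
    Finset.sum_neg_distrib, sub_eq_add_neg]

theorem covectorWedge_zero_vecCons (θ : M →ₗ[ℝ] A) (G : M [⋀^Fin 0]→ₗ[ℝ] A) (w : M)
    (v : Fin 0 → M) : covectorWedge θ G (Matrix.vecCons w v) = θ w * G v := by
  rw [covectorWedge_apply, Fin.sum_univ_succ, Fin.sum_univ_zero]
  have : (Fin.removeNth 0 (Matrix.vecCons w v : Fin 1 → M)) = v :=
    Subsingleton.elim _ _
  simp [this]

end CovectorWedge

/-! ### Polynomial-valued forms and generic covectors -/

section GenericCovectors

open MvPolynomial

variable {n : ℕ}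

/-- Alternating forms on `ℝⁿ` whose values are polynomials in the components `λ_{j,i}`,
`j ∈ ℕ`, `i ∈ Fin n`, of generic covectors `λ₀, λ₁, …`. -/
abbrev PolyForm (n p : ℕ) : Type :=
  (Fin n → ℝ) [⋀^Fin p]→ₗ[ℝ] MvPolynomial (ℕ × Fin n) ℝ

/-- The `j`-th generic covector `λ_j = ∑ λ_{j,i} dxⁱ`. -/
def genericCovector (j : ℕ) : (Fin n → ℝ) →ₗ[ℝ] MvPolynomial (ℕ × Fin n) ℝ :=
  ∑ i, (LinearMap.toSpanSingleton ℝ _ (X (j, i))).comp (LinearMap.proj i)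

theorem genericCovector_apply (j : ℕ) (v : Fin n → ℝ) :
    genericCovector j v = ∑ i, v i • X (j, i) := by
  simp [genericCovector]

theorem genericCovector_single (j : ℕ) (i : Fin n) :
    genericCovector j (Pi.single i 1) = X (j, i) := by
  simp [genericCovector_apply, Pi.single_apply]

/-- The exterior product `λ_j ∧ F`. -/
abbrev wedgeGeneric (j : ℕ) {p : ℕ} (F : PolyForm n p) : PolyForm n (p + 1) :=
  covectorWedge (genericCovector j) F

/-- The polarization operator `∑ᵢ λ_{l,i} ∂/∂λ_{j,i}`. -/
def polarization (l j : ℕ) :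
    Derivation ℝ (MvPolynomial (ℕ × Fin n) ℝ) (MvPolynomial (ℕ × Fin n) ℝ) :=
  ∑ i, (X (l, i) : MvPolynomial (ℕ × Fin n) ℝ) • pderiv (j, i)

theorem polarization_apply (l j : ℕ) (f : MvPolynomial (ℕ × Fin n) ℝ) :
    polarization l j f = ∑ i, X (l, i) * pderiv (j, i) f := by
  have h := congrFun (map_sum (Derivation.coeFnAddMonoidHom (R := ℝ)
    (A := MvPolynomial (ℕ × Fin n) ℝ) (M := MvPolynomial (ℕ × Fin n) ℝ))
    (fun i => (X (l, i) : MvPolynomial (ℕ × Fin n) ℝ) • pderiv (j, i)) Finset.univ) f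
  exact h.trans (by rw [Finset.sum_apply]; rfl)

/-- The polarization operators act on polynomial-valued forms through their values. -/
def polarize (l j : ℕ) {p : ℕ} (F : PolyForm n p) : PolyForm n p :=
  (polarization l j).toLinearMap.compAlternatingMap F

theorem polarize_apply (l j : ℕ) {p : ℕ} (F : PolyForm n p) (v : Fin p → Fin n → ℝ) :
    polarize l j F v = polarization l j (F v) := rfl

/-- The divergence `∑ᵢ ∂/∂λ_{j,i} ι(∂ᵢ) F`, the formal adjoint of `λ_j ∧ ·`. -/
def divergence (j : ℕ) {p : ℕ} (F : PolyForm n (p + 1)) : PolyForm n p :=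
  ∑ i, (pderiv (j, i)).toLinearMap.compAlternatingMap (F.curryLeft (Pi.single i 1))

theorem divergence_apply (j : ℕ) {p : ℕ} (F : PolyForm n (p + 1)) (v : Fin p → Fin n → ℝ) :
    divergence j F v = ∑ i, pderiv (j, i) (F (Matrix.vecCons (Pi.single i 1) v)) := by
  simp [divergence, alternatingMap_sum_apply]

/-- Forms whose divergence with respect to `λ_j` vanishes; in degree `0` this is no condition. -/
def IsDivFree (j : ℕ) : {p : ℕ} → PolyForm n p → Prop
  | 0, _ => True
  | _ + 1, F => divergence j F = 0

theorem sum_single_smul_eq {N : Type*} [AddCommGroup N] [Module ℝ N] {p : ℕ}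
    (F : (Fin n → ℝ) [⋀^Fin (p + 1)]→ₗ[ℝ] N) (w : Fin n → ℝ) (v : Fin p → Fin n → ℝ) :
    ∑ i, w i • F (Matrix.vecCons (Pi.single i 1) v) = F (Matrix.vecCons w v) := by
  have h : w = ∑ i, w i • Pi.single (M := fun _ => ℝ) i 1 := by
    ext k; simp [Finset.sum_apply, Pi.single_apply]
  have h2 : ∀ u, F (Matrix.vecCons u v) = F.curryLeft u v := fun _ => rfl
  simp only [h2]
  conv_rhs => rw [h]
  simp [alternatingMap_sum_apply]

theorem pderiv_genericCovector (j l : ℕ) (i : Fin n) (w : Fin n → ℝ) :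
    pderiv (j, i) (genericCovector l w) = if j = l then C (w i) else 0 := by
  rw [genericCovector_apply, map_sum]
  simp only [Derivation.map_smul, pderiv_X, Pi.single_apply, Prod.mk.injEq]
  split_ifs with h
  · subst h
    simp [MvPolynomial.smul_eq_C_mul]
  · simp [Ne.symm h]

/-- The commutation relation `∑ᵢ ∂/∂λ_{j,i} λ_{l,i} = λ_l · ∂/∂λ_j + n δ_{jl}`. -/
theorem sum_pderiv_X_mul (j l : ℕ) (f : MvPolynomial (ℕ × Fin n) ℝ) :
    ∑ i, pderiv (j, i) (X (l, i) * f) = polarization l j f + if j = l then (n : ℝ) • f else 0 := by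
  simp only [Derivation.leibniz, pderiv_X, smul_eq_mul, polarization_apply,
    Finset.sum_add_distrib, Pi.single_apply, Prod.mk.injEq, and_true]
  congr 1
  by_cases h : j = l
  · subst h
    simp [MvPolynomial.smul_eq_C_mul]
  · simp [h, Ne.symm h]

theorem divergence_wedgeGeneric_zero (j l : ℕ) (G : PolyForm n 0) :
    divergence j (wedgeGeneric l G) = polarize l j G + if j = l then (n : ℝ) • G else 0 := by
  refine AlternatingMap.ext fun v => ?_
  have h : ∀ i, wedgeGeneric l G (Matrix.vecCons (Pi.single i 1) v) = X (l, i) * G v := by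
    intro i
    rw [covectorWedge_zero_vecCons, genericCovector_single]
  simp only [divergence_apply, h, sum_pderiv_X_mul, AlternatingMap.add_apply, polarize_apply]
  split_ifs <;> simp

/-- The anticommutator of `λ_l ∧ ·` and the divergence is a polarization operator plus, for
`j = l`, a scalar counting the missing directions. -/
theorem divergence_wedgeGeneric (j l : ℕ) {p : ℕ} (G : PolyForm n (p + 1)) :
    divergence j (wedgeGeneric l G) =
      polarize l j G + (if j = l then ((n : ℝ) - (p + 1 : ℕ)) • G else 0) -
        wedgeGeneric l (divergence j G) := by
  refine AlternatingMap.ext fun v => ?_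
  have h1 : ∀ s : Fin (p + 1), ∑ i, pderiv (j, i)
      (genericCovector l (v s) * G (Matrix.vecCons (Pi.single i 1) (s.removeNth v))) =
      genericCovector l (v s) * divergence j G (s.removeNth v) +
        if j = l then (-1) ^ (s : ℕ) * G v else 0 := by
    intro s
    simp only [Derivation.leibniz, smul_eq_mul, Finset.sum_add_distrib, divergence_apply,
      Finset.mul_sum, pderiv_genericCovector]
    congr 1
    split_ifs with h
    · have := sum_single_smul_eq G (v s) (s.removeNth v)
      simp only [MvPolynomial.smul_eq_C_mul] at this
      simp only [mul_comm _ (C _), this]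
      rw [← AlternatingMap.neg_one_pow_smul_map_insertNth G s, Fin.insertNth_self_removeNth]
      rw [zsmul_eq_mul]
      simp
    · simp
  have h3 : ∀ i, pderiv (j, i) (wedgeGeneric l G (Matrix.vecCons (Pi.single i 1) v)) =
      pderiv (j, i) (X (l, i) * G v) - ∑ s : Fin (p + 1), (-1) ^ (s : ℕ) * pderiv (j, i)
        (genericCovector l (v s) * G (Matrix.vecCons (Pi.single i 1) (s.removeNth v))) := by
    intro i
    rw [covectorWedge_vecCons, map_sub, map_sum, genericCovector_single]
    congr 1
    refine Finset.sum_congr rfl fun s _ => ?_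
    rcases neg_one_pow_eq_or (MvPolynomial (ℕ × Fin n) ℝ) (s : ℕ) with h | h <;> simp [h]
  rw [divergence_apply, Finset.sum_congr rfl fun i _ => h3 i, Finset.sum_sub_distrib,
    Finset.sum_comm]
  rw [sum_pderiv_X_mul]
  simp only [← Finset.mul_sum, h1, mul_add, Finset.sum_add_distrib]
  simp only [AlternatingMap.sub_apply, AlternatingMap.add_apply, polarize_apply,
    covectorWedge_apply]
  split_ifs with h
  · simp only [← mul_assoc, ← mul_pow, neg_mul_neg, mul_one, one_pow, one_mul, Finset.sum_const,
      Finset.card_univ, Fintype.card_fin, AlternatingMap.smul_apply, sub_smul, Nat.cast_smul_eq_nsmul]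
    abel
  · simp

theorem polarize_wedgeGeneric (l j s : ℕ) {p : ℕ} (F : PolyForm n p) :
    polarize l j (wedgeGeneric s F) =
      wedgeGeneric s (polarize l j F) + if j = s then wedgeGeneric l F else 0 := by
  have hg : ∀ w : Fin n → ℝ, polarization l j (genericCovector s w) =
      if j = s then genericCovector l w else 0 := by
    intro w
    simp only [polarization_apply, pderiv_genericCovector]
    split_ifs
    · simp [genericCovector_apply, MvPolynomial.smul_eq_C_mul, mul_comm]
    · simp
  refine AlternatingMap.ext fun v => ?_
  have hs : ∀ k : ℕ, ∀ f : MvPolynomial (ℕ × Fin n) ℝ,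
      polarization l j ((-1) ^ k * f) = (-1) ^ k * polarization l j f := by
    intro k f
    rcases neg_one_pow_eq_or (MvPolynomial (ℕ × Fin n) ℝ) k with h | h <;> simp [h]
  simp only [polarize_apply, covectorWedge_apply, map_sum, hs, Derivation.leibniz, smul_eq_mul, hg,
    AlternatingMap.add_apply, mul_add, Finset.sum_add_distrib]
  congr 1
  split_ifs
  · simp only [covectorWedge_apply]
    exact Finset.sum_congr rfl fun _ _ => by ring
  · simp

/-- The iterated exterior product `λ_{k-1} ∧ ⋯ ∧ λ₁ ∧ λ₀ ∧ F`. -/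
def wedgeGenericIter {p : ℕ} : (k : ℕ) → PolyForm n p → PolyForm n (p + k)
  | 0, F => F
  | k + 1, F => wedgeGeneric k (wedgeGenericIter k F)

theorem wedgeGeneric_wedgeGenericIter {s k : ℕ} (hs : s < k) {p : ℕ} (F : PolyForm n p) :
    wedgeGeneric s (wedgeGenericIter k F) = 0 := by
  induction k with
  | zero => omega
  | succ k ih =>
    rw [wedgeGenericIter]
    rcases Nat.lt_succ_iff_lt_or_eq.1 hs with h | rfl
    · rw [wedgeGeneric, covectorWedge_comm]
      change -wedgeGeneric k (wedgeGeneric s (wedgeGenericIter k F)) = 0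
      rw [ih h, wedgeGeneric, covectorWedge_zero_right, neg_zero]
    · exact covectorWedge_self _ _

theorem polarize_wedgeGenericIter_of_le (l : ℕ) {j k : ℕ} (hk : k ≤ j) {p : ℕ} (F : PolyForm n p) :
    polarize l j (wedgeGenericIter k F) = wedgeGenericIter k (polarize l j F) := by
  induction k with
  | zero => rfl
  | succ k ih =>
    simp only [wedgeGenericIter]
    rw [polarize_wedgeGeneric, ih (by omega), if_neg (by omega), add_zero]

/-- Replacing `λ_j` by `λ_l` in a product containing `λ_l` gives zero, hence the polarization
operators commute with the exterior product by all generic covectors. -/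
theorem polarize_wedgeGenericIter {l j k : ℕ} (hl : l < j) (hj : j < k) {p : ℕ}
    (F : PolyForm n p) :
    polarize l j (wedgeGenericIter k F) = wedgeGenericIter k (polarize l j F) := by
  induction k with
  | zero => omega
  | succ k ih =>
    simp only [wedgeGenericIter]
    rw [polarize_wedgeGeneric]
    rcases Nat.lt_succ_iff_lt_or_eq.1 hj with h | rfl
    · rw [ih h, if_neg (by omega), add_zero]
    · rw [polarize_wedgeGenericIter_of_le l le_rfl, if_pos rfl, wedgeGeneric_wedgeGenericIter hl,
        add_zero]

theorem pderiv_polarization (s l j : ℕ) (i : Fin n) (f : MvPolynomial (ℕ × Fin n) ℝ) :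
    pderiv (s, i) (polarization l j f) =
      polarization l j (pderiv (s, i) f) + if s = l then pderiv (j, i) f else 0 := by
  have hc : ∀ a b : ℕ × Fin n, pderiv a (pderiv b f) = pderiv b (pderiv a f) := by
    intro a b
    have h : ⁅(pderiv a : Derivation ℝ (MvPolynomial (ℕ × Fin n) ℝ) (MvPolynomial (ℕ × Fin n) ℝ)),
        (pderiv b : Derivation ℝ (MvPolynomial (ℕ × Fin n) ℝ) (MvPolynomial (ℕ × Fin n) ℝ))⁆ = 0 := by
      refine MvPolynomial.derivation_ext fun c => ?_
      simp only [Derivation.commutator_apply, pderiv_X, Derivation.zero_apply, Pi.single_apply]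
      split_ifs <;> simp
    have := congrArg (fun D : Derivation ℝ _ _ => D f) h
    simpa [Derivation.commutator_apply, sub_eq_zero] using this
  simp only [polarization_apply, map_sum, Derivation.leibniz, smul_eq_mul, pderiv_X,
    Finset.sum_add_distrib, fun x => hc (s, i) (j, x)]
  congr 1
  by_cases h : s = l
  · subst h
    simp [Pi.single_apply]
  · simp [h, Ne.symm h]

theorem divergence_polarize (s l j : ℕ) {p : ℕ} (F : PolyForm n (p + 1)) :
    divergence s (polarize l j F) =
      polarize l j (divergence s F) + if s = l then divergence j F else 0 := by
  refine AlternatingMap.ext fun v => ?_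
  simp only [AlternatingMap.add_apply, divergence_apply, polarize_apply, pderiv_polarization,
    map_sum, Finset.sum_add_distrib]
  split_ifs
  · simp [divergence_apply]
  · simp

@[simp]
theorem polarize_zero (l j p : ℕ) : polarize l j (0 : PolyForm n p) = 0 := by
  refine AlternatingMap.ext fun v => ?_
  simp [polarize_apply]

theorem IsDivFree.polarize {s j p : ℕ} {F : PolyForm n p} (hs : IsDivFree s F)
    (hj : IsDivFree j F) (l : ℕ) : IsDivFree s (polarize l j F) := by
  cases p with
  | zero => trivial
  | succ p =>
    change divergence s F = 0 at hs
    change divergence j F = 0 at hj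
    change divergence s (JetContact.polarize l j F) = 0
    rw [divergence_polarize, hs, hj]
    simp

/-- If `G` is also annihilated by the polarization replacing `λ_j` by `λ_l`, then multiplication by
`λ_l`, `l ≠ j`, preserves divergence freeness with respect to `λ_j`. -/
theorem IsDivFree.wedgeGeneric {j l p : ℕ} {G : PolyForm n p} (hG : IsDivFree j G) (hjl : j ≠ l)
    (hp : JetContact.polarize l j G = 0) : IsDivFree j (wedgeGeneric l G) := by
  change divergence j _ = 0
  cases p with
  | zero => rw [divergence_wedgeGeneric_zero, hp, if_neg hjl, add_zero]
  | succ p =>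
    change divergence j G = 0 at hG
    rw [JetContact.divergence_wedgeGeneric, hp, if_neg hjl, hG]
    simp

theorem IsDivFree.divergence_wedgeGeneric {j p : ℕ} {G : PolyForm n p} (hG : IsDivFree j G) :
    divergence j (JetContact.wedgeGeneric j G) =
      JetContact.polarize j j G + ((n : ℝ) - p) • G := by
  cases p with
  | zero => rw [divergence_wedgeGeneric_zero]; simp
  | succ p =>
    change divergence j G = 0 at hG
    rw [JetContact.divergence_wedgeGeneric, hG]
    simp

/-- The polarization `λ_j · ∂/∂λ_j` is the Euler operator: it multiplies a monomial by its degree in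
`λ_j`. -/
theorem coeff_polarization_self (j : ℕ) (f : MvPolynomial (ℕ × Fin n) ℝ) (N : ℕ × Fin n →₀ ℕ) :
    (polarization j j f).coeff N = (∑ i, (N (j, i) : ℝ)) * f.coeff N := by
  classical
  rw [polarization_apply, coeff_sum, Finset.sum_mul]
  refine Finset.sum_congr rfl fun i _ => ?_
  rw [coeff_X_mul']
  split_ifs with h
  · have h1 : 1 ≤ N (j, i) := Nat.one_le_iff_ne_zero.2 (Finsupp.mem_support_iff.1 h)
    rw [coeff_pderiv, tsub_add_cancel_of_le (Finsupp.single_le_iff.2 h1)]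
    simp [Nat.cast_sub h1, mul_comm]
  · simp [Finsupp.notMem_support_iff.1 h]

/-- A form of degree `0` in `λ_j` does not involve `λ_j`, so all polarizations which differentiate in
the direction of `λ_j` annihilate it. -/
theorem polarize_eq_zero_of_weight_zero {l j p : ℕ} {F : PolyForm n p}
    (hF : polarize j j F = 0) : polarize l j F = 0 := by
  refine AlternatingMap.ext fun v => ?_
  rw [polarize_apply, polarization_apply]
  refine Finset.sum_eq_zero fun i _ => ?_
  have h : pderiv (j, i) (F v) = 0 := by
    ext N
    have h1 := coeff_polarization_self j (F v) (N + Finsupp.single (j, i) 1)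
    rw [← polarize_apply, hF, AlternatingMap.zero_apply, coeff_zero, eq_comm, mul_eq_zero] at h1
    rw [coeff_pderiv]
    rcases h1 with h1 | h1
    · rw [Finset.sum_eq_zero_iff_of_nonneg fun _ _ => Nat.cast_nonneg _] at h1
      have := h1 i (Finset.mem_univ i)
      norm_cast at this
      simp at this
    · simp [h1]
  rw [h, mul_zero]

theorem polarization_X (l j : ℕ) (c : ℕ × Fin n) :
    polarization l j (X c) = if j = c.1 then X (l, c.2) else 0 := by
  obtain ⟨a, b⟩ := c
  simp only [polarization_apply, pderiv_X, Pi.single_apply, Prod.mk.injEq]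
  split_ifs with h
  · simp [h]
  · simp [Ne.symm h]

/-- Polarization from `λ_j` to `λ_l` raises the degree in `λ_l` by one and lowers the degree in `λ_j`
by one. -/
theorem polarize_self_polarize (s : ℕ) {l j : ℕ} (hlj : l ≠ j) {p : ℕ} (F : PolyForm n p) :
    polarize s s (polarize l j F) = polarize l j (polarize s s F) +
      (if s = l then polarize l j F else 0) - if s = j then polarize l j F else 0 := by
  have h : ⁅polarization (n := n) s s, polarization (n := n) l j⁆ =
      (if s = l then polarization l j else 0) - if s = j then polarization l j else 0 := by
    refine MvPolynomial.derivation_ext fun c => ?_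
    rw [Derivation.commutator_apply, polarization_X, polarization_X]
    by_cases h1 : j = c.1 <;> by_cases h2 : s = l <;> by_cases h3 : s = j <;>
      by_cases h4 : s = c.1 <;>
      simp_all [polarization_X]
  refine AlternatingMap.ext fun v => ?_
  have h5 := congrArg (fun D : Derivation ℝ _ _ => D (F v)) h
  simp only [Derivation.commutator_apply, Derivation.sub_apply] at h5
  rw [add_sub_assoc, AlternatingMap.add_apply, AlternatingMap.sub_apply]
  simp only [polarize_apply]
  rw [← sub_eq_iff_eq_add', h5]
  split_ifs <;> simp [polarize_apply]

theorem wedgeGenericIter_zero (k p : ℕ) : wedgeGenericIter k (0 : PolyForm n p) = 0 := by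
  induction k with
  | zero => rfl
  | succ k ih => rw [wedgeGenericIter, ih, wedgeGeneric, covectorWedge_zero_right]

theorem wedgeGenericIter_smul (k : ℕ) (c : ℝ) {p : ℕ} (F : PolyForm n p) :
    wedgeGenericIter k (c • F) = c • wedgeGenericIter k F := by
  induction k with
  | zero => rfl
  | succ k ih =>
    rw [wedgeGenericIter, ih]
    refine AlternatingMap.ext fun v => ?_
    simp [wedgeGenericIter, covectorWedge_apply, Finset.smul_sum]

/-- A polynomial-valued form of degree `p` which is divergence free with respect to
`λ₀, …, λ_{k-1}` and whose product with `λ₀ ∧ ⋯ ∧ λ_{k-1}` vanishes is zero, provided that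
`p + k ≤ n`. After induction on the multidegree `d`, the form is a highest weight vector: it is
annihilated by the polarizations `λ_l ∂/∂λ_j` with `l < j`. Then the factors `λ_j` can be cancelled
one at a time, because the divergence of `λ_j ∧ G` is a positive multiple of `G`. -/
theorem eq_zero_of_wedgeGenericIter_eq_zero {k : ℕ} {p : ℕ} (hpk : p + k ≤ n) (D : ℕ) :
    ∀ (d : ℕ → ℕ) (F : PolyForm n p), ∑ j ∈ Finset.range k, j * d j = D →
      (∀ j < k, polarize j j F = (d j : ℝ) • F) → (∀ j < k, IsDivFree j F) →
      wedgeGenericIter k F = 0 → F = 0 := by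
  induction D using Nat.strong_induction_on with
  | _ D ih =>
  intro d F hD hd hF hk
  -- `polarize l j F` satisfies the same hypotheses, and `D = ∑ j d_j` drops by `j - l`
  have hpol : ∀ l j, l < j → j < k → polarize l j F = 0 := by
    intro l j hl hj
    by_cases h0 : d j = 0
    · refine polarize_eq_zero_of_weight_zero ?_
      rw [hd j hj, h0]; simp
    have hcomm : ∀ s < k, polarize s s (polarize l j F) =
        (((Function.update (Function.update d j (d j - 1)) l (d l + 1)) s : ℕ) : ℝ) •
          polarize l j F := by
      intro s hs
      have h1 := polarize_self_polarize s hl.ne F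
      have h2 : polarize l j (polarize s s F) = (d s : ℝ) • polarize l j F := by
        rw [hd s hs]
        refine AlternatingMap.ext fun v => ?_
        simp [polarize_apply]
      rw [h1, h2]
      rcases eq_or_ne s l with rfl | hsl
      · rw [if_pos rfl, if_neg hl.ne, sub_zero, Function.update_self]
        push_cast
        rw [add_smul, one_smul]
      rcases eq_or_ne s j with rfl | hsj
      · rw [if_neg hsl, if_pos rfl, add_zero, Function.update_of_ne hsl, Function.update_self,
          Nat.cast_sub (Nat.one_le_iff_ne_zero.2 h0)]
        refine AlternatingMap.ext fun v => ?_
        simp [sub_smul]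
      · rw [if_neg hsl, if_neg hsj, Function.update_of_ne hsl, Function.update_of_ne hsj]
        simp
    refine ih _ ?_ _ _ rfl hcomm (fun s hs => (hF s hs).polarize (hF j hj) l) ?_
    · have h3 : ∀ s ∈ Finset.range k,
          s * Function.update (Function.update d j (d j - 1)) l (d l + 1) s + (if s = j then j else 0) =
            s * d s + if s = l then l else 0 := by
        intro s _
        rcases eq_or_ne s l with rfl | hsl
        · simp [hl.ne, mul_add]
        rcases eq_or_ne s j with rfl | hsj
        · obtain ⟨e, he⟩ := Nat.exists_eq_succ_of_ne_zero h0
          simp [hsl, he, mul_add]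
        · simp [hsl, hsj]
      have h4 := Finset.sum_congr rfl h3
      rw [Finset.sum_add_distrib, Finset.sum_add_distrib, hD, Finset.sum_ite_eq',
        Finset.sum_ite_eq', if_pos (Finset.mem_range.2 hj),
        if_pos (Finset.mem_range.2 (hl.trans hj))] at h4
      omega
    · rw [← polarize_wedgeGenericIter hl hj, hk, polarize_zero]
  -- the factors `λ_s`, `s < k'`, do not affect the divergence with respect to `λ_j`, `k' ≤ j`,
  -- since the polarizations from `λ_j` to `λ_s` annihilate `F`
  have hfree : ∀ k' ≤ k, ∀ j, k' ≤ j → j < k → IsDivFree j (wedgeGenericIter k' F) := by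
    intro k'
    induction k' with
    | zero => exact fun _ j _ hj => hF j hj
    | succ k' ih' =>
      intro hk' j hj hjk
      refine (ih' (by omega) j (by omega) hjk).wedgeGeneric (by omega) ?_
      rw [polarize_wedgeGenericIter_of_le _ (by omega), hpol k' j (by omega) hjk,
        wedgeGenericIter_zero]
  have hdown : ∀ k' ≤ k, wedgeGenericIter k' F = 0 → F = 0 := by
    intro k'
    induction k' with
    | zero => exact fun _ h => h
    | succ k' ih' =>
      intro hk' h
      refine ih' (by omega) ?_
      have h1 := (hfree k' (by omega) k' le_rfl (by omega)).divergence_wedgeGeneric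
      have h2 : wedgeGeneric k' (wedgeGenericIter k' F) = 0 := h
      rw [h2, polarize_wedgeGenericIter_of_le _ le_rfl, hd k' (by omega)] at h1
      refine AlternatingMap.ext fun v => ?_
      have h3 := congrArg (fun G : PolyForm n (p + k') => G v) h1
      have h4 : wedgeGenericIter k' ((d k' : ℝ) • F) = (d k' : ℝ) • wedgeGenericIter k' F :=
        wedgeGenericIter_smul _ _ _
      have h5 : divergence k' (0 : PolyForm n (p + k' + 1)) = 0 := by
        refine AlternatingMap.ext fun v => ?_
        simp [divergence_apply]
      simp only [h4, h5, AlternatingMap.smul_apply, ← add_smul,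
        AlternatingMap.zero_apply] at h3
      refine (smul_eq_zero.1 h3.symm).resolve_left (ne_of_gt ?_)
      -- the scalar is at least `n - (p + k') > 0`, as `k' < k`
      have h6 : ((p + k' : ℕ) : ℝ) < n := by exact_mod_cast (by omega : p + k' < n)
      have h7 : (0 : ℝ) ≤ d k' := Nat.cast_nonneg _
      linarith
  exact hdown k le_rfl hk

end GenericCovectors

/-! ### Shears and forms vanishing on integral elements -/

section Shear

variable {M N A : Type*} [AddCommGroup M] [Module ℝ M] [AddCommGroup N] [Module ℝ N]
  [CommRing A] [Algebra ℝ A] {p : ℕ}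

theorem covectorWedge_compLinearMap (θ : M →ₗ[ℝ] A) (F : M [⋀^Fin p]→ₗ[ℝ] A) (g : N →ₗ[ℝ] M) :
    (covectorWedge θ F).compLinearMap g = covectorWedge (θ ∘ₗ g) (F.compLinearMap g) := by
  refine AlternatingMap.ext fun v => ?_
  simp only [AlternatingMap.compLinearMap_apply, covectorWedge_apply]
  rfl

theorem covectorWedge_neg_right (θ : M →ₗ[ℝ] A) (F : M [⋀^Fin p]→ₗ[ℝ] A) :
    covectorWedge θ (-F) = -covectorWedge θ F := by
  refine AlternatingMap.ext fun v => ?_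
  simp [covectorWedge_apply]

theorem curryLeft_curryLeft_swap (β : M [⋀^Fin (p + 2)]→ₗ[ℝ] A) (u w : M) :
    (β.curryLeft u).curryLeft w = -(β.curryLeft w).curryLeft u := by
  have h := AlternatingMap.curryLeft_same β (u + w)
  simp only [map_add, LinearMap.add_apply, AlternatingMap.curryLeft_same, AlternatingMap.curryLeft_add,
    zero_add, add_zero] at h
  exact eq_neg_of_add_eq_zero_right h

/-- Contraction with a vector `u` on which `θ` vanishes anticommutes with `θ ∧ ·`. -/
theorem curryLeft_covectorWedge (θ : M →ₗ[ℝ] A) (G : M [⋀^Fin (p + 1)]→ₗ[ℝ] A) {u : M}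
    (hu : θ u = 0) :
    (covectorWedge θ G).curryLeft u = -covectorWedge θ (G.curryLeft u) := by
  refine AlternatingMap.ext fun v => ?_
  rw [AlternatingMap.curryLeft_apply_apply, covectorWedge_vecCons, hu, zero_mul, zero_sub,
    AlternatingMap.neg_apply, covectorWedge_apply]
  rfl

/-- The pull-back of a form along a rank one perturbation `g + θ ⊗ u` of `g`. -/
theorem compLinearMap_add_smulRight (g : N →ₗ[ℝ] M) (θ : N →ₗ[ℝ] ℝ) (u : M) {p : ℕ}
    (β : M [⋀^Fin (p + 1)]→ₗ[ℝ] ℝ) :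
    β.compLinearMap (g + θ.smulRight u) =
      β.compLinearMap g + covectorWedge θ ((β.curryLeft u).compLinearMap g) := by
  have key : ∀ {q : ℕ} (γ : M [⋀^Fin (q + 1)]→ₗ[ℝ] ℝ) (h : N →ₗ[ℝ] M) (v : Fin (q + 1) → N),
      γ.compLinearMap h v =
        (γ.curryLeft (h (v 0))).compLinearMap h (fun i => v i.succ) := by
    intro q γ h v
    simp only [AlternatingMap.compLinearMap_apply, AlternatingMap.curryLeft_apply_apply]
    congr 1
    funext i
    refine Fin.cases ?_ (fun i => ?_) i <;> rfl
  induction p with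
  | zero =>
    refine AlternatingMap.ext fun v => ?_
    obtain ⟨w, t, rfl⟩ : ∃ w t, v = Matrix.vecCons w t :=
      ⟨v 0, fun i => v i.succ, by funext i; refine Fin.cases ?_ (fun i => ?_) i <;> rfl⟩
    rw [AlternatingMap.add_apply, covectorWedge_zero_vecCons, key β (g + _), key β g]
    simp only [Matrix.cons_val_zero, LinearMap.add_apply, LinearMap.smulRight_apply, map_add,
      map_smul, AlternatingMap.compLinearMap_apply, AlternatingMap.add_apply,
      AlternatingMap.smul_apply, smul_eq_mul]
    congr 2
    · exact Subsingleton.elim (α := Fin 0 → M) _ _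
    · congr 1
      exact Subsingleton.elim (α := Fin 0 → M) _ _
  | succ p ih =>
    refine AlternatingMap.ext fun v => ?_
    obtain ⟨w, t, rfl⟩ : ∃ w t, v = Matrix.vecCons w t :=
      ⟨v 0, fun i => v i.succ, by funext i; refine Fin.cases ?_ (fun i => ?_) i <;> rfl⟩
    rw [AlternatingMap.add_apply, covectorWedge_vecCons, key β (g + _), key β g]
    simp only [Matrix.cons_val_zero, Matrix.cons_val_succ, LinearMap.add_apply,
      LinearMap.smulRight_apply, map_add, map_smul]
    have h1 : ∀ γ : M [⋀^Fin (p + 1)]→ₗ[ℝ] ℝ, γ.compLinearMap (g + θ.smulRight u) t =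
        γ.compLinearMap g t + covectorWedge θ ((γ.curryLeft u).compLinearMap g) t := fun γ => by
      rw [ih, AlternatingMap.add_apply]
    have h2 : ∀ γ γ' : M [⋀^Fin (p + 1)]→ₗ[ℝ] ℝ, ∀ c : ℝ,
        (γ + c • γ').compLinearMap (g + θ.smulRight u) t =
          γ.compLinearMap (g + θ.smulRight u) t + c * γ'.compLinearMap (g + θ.smulRight u) t :=
      fun γ γ' c => rfl
    have h0 : (0 : M [⋀^Fin p]→ₗ[ℝ] ℝ).compLinearMap g = 0 := rfl
    change (β.curryLeft (g w) + θ w • β.curryLeft u).compLinearMap (g + θ.smulRight u) t = _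
    rw [h2, h1, h1, AlternatingMap.curryLeft_same, h0, covectorWedge_zero_right,
      AlternatingMap.zero_apply, add_zero, add_assoc, curryLeft_curryLeft_swap]
    change _ + (covectorWedge θ (-((β.curryLeft u).curryLeft (g w)).compLinearMap g) t + _) = _
    rw [covectorWedge_neg_right, AlternatingMap.neg_apply, covectorWedge_apply, neg_add_eq_sub]
    congr 3
    funext s
    rw [key ((β.curryLeft u)) g]
    rfl

end Shear

section IntegralElements

variable {n m r : ℕ}

/-- The coordinate vector `∂/∂xⁱ`. -/
def baseVector (i : Fin n) : JetCoord n m r := (Pi.single i 1, 0)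

/-- The coordinate vector `∂/∂y^σ_J`. -/
def fibreVector (σ : Fin m) (J : MultiIndex n (r + 1)) : JetCoord n m r :=
  (0, Pi.single σ (Pi.single J 1))

theorem dy_fibreVector (σ τ : Fin m) (J K : MultiIndex n (r + 1)) :
    dy τ J (fibreVector σ K) = if τ = σ ∧ J = K then 1 else 0 := by
  change (Pi.single σ (Pi.single K (1 : ℝ)) : Fin m → MultiIndex n (r + 1) → ℝ) τ J = _
  by_cases h : τ = σ
  · subst h
    simp [Pi.single_apply]
  · simp [h]

/-- The map `v ↦ (v, ∑ᵢ a^σ_{iJ} vⁱ)`, `|J| = r`, parametrizing an `n`-plane transversal to the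
fibres, on which the forms `dy^σ_J`, `|J| < r`, vanish. -/
def integralElement (r : ℕ) (a : Fin m → Multiset (Fin n) → ℝ) :
    (Fin n → ℝ) →ₗ[ℝ] JetCoord n m r where
  toFun v := (v, fun σ J => if Multiset.card J.1 = r then ∑ i, a σ (i ::ₘ J.1) * v i else 0)
  map_add' v w := by
    refine Prod.ext rfl ?_
    funext σ J
    by_cases h : Multiset.card J.1 = r <;> simp [h, mul_add, Finset.sum_add_distrib]
  map_smul' c v := by
    refine Prod.ext rfl ?_
    funext σ J
    by_cases h : Multiset.card J.1 = r <;> simp [h, Finset.mul_sum, mul_left_comm]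

theorem integralElement_apply (a : Fin m → Multiset (Fin n) → ℝ) (v : Fin n → ℝ) :
    integralElement r a v = (v, fun σ J =>
      if Multiset.card J.1 = r then ∑ i, a σ (i ::ₘ J.1) * v i else 0) := rfl

/-- The vector `∑_{|J| = r} λ^J ∂/∂y^σ_J`. -/
def powerVector (r : ℕ) (σ : Fin m) (l : Fin n → ℝ) : JetCoord n m r :=
  ∑ J : MultiIndex n (r + 1) with Multiset.card J.1 = r, (J.1.map l).prod • fibreVector σ J

theorem powerVector_fst (σ : Fin m) (l : Fin n → ℝ) : (powerVector r σ l).1 = 0 := by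
  simp [powerVector, fibreVector, Prod.fst_sum]

theorem powerVector_snd (σ τ : Fin m) (l : Fin n → ℝ) (J : MultiIndex n (r + 1)) :
    (powerVector r σ l).2 τ J =
      if τ = σ ∧ Multiset.card J.1 = r then (J.1.map l).prod else 0 := by
  change dy τ J (powerVector r σ l) = _
  simp only [powerVector, map_sum, map_smul, dy_fibreVector]
  rw [Finset.sum_filter]
  by_cases h : τ = σ
  · rw [Finset.sum_eq_single J (fun K _ hK => by simp [Ne.symm hK]) (by simp)]
    simp [h]
  · simp [h]

/-- The covector `∑ᵢ λᵢ dxⁱ`. -/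
def covector (l : Fin n → ℝ) : (Fin n → ℝ) →ₗ[ℝ] ℝ := ∑ i, l i • LinearMap.proj i

theorem covector_apply (l v : Fin n → ℝ) : covector l v = ∑ i, l i * v i := by
  simp [covector]

/-- Adding the `(r+1)`-st power of a covector to `a` changes the integral element by a shear. -/
theorem integralElement_add_power (a : Fin m → Multiset (Fin n) → ℝ) (σ : Fin m) (l : Fin n → ℝ) :
    integralElement r (fun τ K => a τ K + if τ = σ then (K.map l).prod else 0) =
      integralElement r a + (covector l).smulRight (powerVector r σ l) := by
  refine LinearMap.ext fun v => ?_
  rw [LinearMap.add_apply, LinearMap.smulRight_apply, integralElement_apply, integralElement_apply]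
  refine Prod.ext ?_ ?_
  · simp [powerVector_fst]
  · funext τ J
    simp only [Prod.snd_add, Prod.smul_snd, Pi.add_apply, Pi.smul_apply, powerVector_snd,
      smul_eq_mul, covector_apply]
    by_cases hJ : Multiset.card J.1 = r
    · by_cases hτ : τ = σ
      · simp only [hJ, hτ, if_true, and_self, Multiset.map_cons, Multiset.prod_cons, add_mul,
          Finset.sum_add_distrib, Finset.sum_mul]
        congr 1
        exact Finset.sum_congr rfl fun i _ => by ring
      · simp [hJ, hτ]
    · simp [hJ]

/-- `γ` vanishes on all integral elements after multiplication by the covectors of the list. -/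
def VanishesAfterWedge : List (Fin n → ℝ) → {p : ℕ} → (JetCoord n m r) [⋀^Fin p]→ₗ[ℝ] ℝ → Prop
  | [], _, γ => ∀ a, γ.compLinearMap (integralElement r a) = 0
  | l :: L, _, γ => VanishesAfterWedge L (covectorWedge (covector l ∘ₗ LinearMap.fst ℝ _ _) γ)

/-- Since `a` is arbitrary, it can be changed by the power of `λ`. The first order term of the
resulting shear gives `λ ∧ ι(u_λ) β`; there are no terms of higher order, as `λ ∧ λ = 0`. -/
theorem VanishesAfterWedge.wedge_contract {L : List (Fin n → ℝ)} (σ : Fin m) (l : Fin n → ℝ) :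
    ∀ {p : ℕ} {β : (JetCoord n m r) [⋀^Fin (p + 1)]→ₗ[ℝ] ℝ}, VanishesAfterWedge L β →
      VanishesAfterWedge (l :: L) (β.curryLeft (powerVector r σ l)) := by
  induction L with
  | nil =>
    intro p β hβ a
    have h := hβ (fun τ K => a τ K + if τ = σ then (K.map l).prod else 0)
    rw [integralElement_add_power, compLinearMap_add_smulRight, hβ a, zero_add] at h
    rw [covectorWedge_compLinearMap, ← h]
    rfl
  | cons l' L ih =>
    intro p β hβ
    have h := ih (β := covectorWedge (covector l' ∘ₗ LinearMap.fst ℝ _ _) β) hβ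
    have hu : (covector l' ∘ₗ LinearMap.fst ℝ _ _) (powerVector r σ l) = 0 := by
      simp [powerVector_fst]
    change VanishesAfterWedge L (covectorWedge _ (covectorWedge _ _))
    rw [covectorWedge_comm]
    change VanishesAfterWedge L (covectorWedge _ _) at h
    rwa [curryLeft_covectorWedge _ _ hu, covectorWedge_neg_right] at h

/-- The contraction of a form with `u_{k-1}`, …, `u₁`, `u₀`, where `u_j` is the power vector
of `λ_j`. -/
def contractIter (σ : ℕ → Fin m) (l : ℕ → Fin n → ℝ) {p : ℕ} :
    (k : ℕ) → (JetCoord n m r) [⋀^Fin (p + k)]→ₗ[ℝ] ℝ → (JetCoord n m r) [⋀^Fin p]→ₗ[ℝ] ℝ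
  | 0, α => α
  | k + 1, α => contractIter σ l k (AlternatingMap.curryLeft α (powerVector r (σ k) (l k)))

/-- The product `λ_{k-1} ∧ ⋯ ∧ λ₀ ∧ γ`. -/
def covectorWedgeIter {M : Type*} [AddCommGroup M] [Module ℝ M] (θ : ℕ → M →ₗ[ℝ] ℝ) {p : ℕ} :
    (k : ℕ) → M [⋀^Fin p]→ₗ[ℝ] ℝ → M [⋀^Fin (p + k)]→ₗ[ℝ] ℝ
  | 0, F => F
  | k + 1, F => covectorWedge (θ k) (covectorWedgeIter θ k F)

theorem covectorWedgeIter_compLinearMap {M N : Type*} [AddCommGroup M] [Module ℝ M]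
    [AddCommGroup N] [Module ℝ N] (θ : ℕ → M →ₗ[ℝ] ℝ) (g : N →ₗ[ℝ] M) {p : ℕ} (k : ℕ)
    (F : M [⋀^Fin p]→ₗ[ℝ] ℝ) :
    (covectorWedgeIter θ k F).compLinearMap g =
      covectorWedgeIter (fun j => θ j ∘ₗ g) k (F.compLinearMap g) := by
  induction k with
  | zero => rfl
  | succ k ih => rw [covectorWedgeIter, covectorWedge_compLinearMap, ih]; rfl

theorem VanishesAfterWedge.contractIter (σ : ℕ → Fin m) (l : ℕ → Fin n → ℝ) {p : ℕ} (k : ℕ) :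
    ∀ {L : List (Fin n → ℝ)} {β : (JetCoord n m r) [⋀^Fin (p + k)]→ₗ[ℝ] ℝ},
      VanishesAfterWedge L β →
        VanishesAfterWedge ((List.range k).map l ++ L) (contractIter σ l k β) := by
  induction k with
  | zero => exact fun h => h
  | succ k ih =>
    intro L β h
    rw [List.range_succ, List.map_append, List.append_assoc]
    exact ih (h.wedge_contract (σ k) (l k))

theorem VanishesAfterWedge.covectorWedgeIter (l : ℕ → Fin n → ℝ) {p : ℕ} (k : ℕ) :
    ∀ {L : List (Fin n → ℝ)} {γ : (JetCoord n m r) [⋀^Fin p]→ₗ[ℝ] ℝ},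
      VanishesAfterWedge ((List.range k).map l ++ L) γ →
        VanishesAfterWedge L
          (covectorWedgeIter (fun j => covector (l j) ∘ₗ LinearMap.fst ℝ _ _) k γ) := by
  induction k with
  | zero => exact fun h => h
  | succ k ih =>
    intro L γ h
    rw [List.range_succ, List.map_append, List.append_assoc] at h
    exact ih h

/-- If a form vanishes on all integral elements, then so does, on the horizontal one,
`λ_{k-1} ∧ ⋯ ∧ λ₀ ∧ ι(u₀) ⋯ ι(u_{k-1}) α`. -/
theorem covectorWedgeIter_contractIter_eq_zero (σ : ℕ → Fin m) (l : ℕ → Fin n → ℝ) {p : ℕ} (k : ℕ)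
    {α : (JetCoord n m r) [⋀^Fin (p + k)]→ₗ[ℝ] ℝ}
    (hα : ∀ a, α.compLinearMap (integralElement r a) = 0) :
    covectorWedgeIter (fun j => covector (l j)) k
      ((contractIter σ l k α).compLinearMap (LinearMap.inl ℝ _ _)) = 0 := by
  have h1 : VanishesAfterWedge [] α := hα
  have h2 := (h1.contractIter σ l k).covectorWedgeIter l k 0
  have h3 : integralElement r (0 : Fin m → Multiset (Fin n) → ℝ) = LinearMap.inl ℝ _ _ := by
    refine LinearMap.ext fun v => ?_
    rw [integralElement_apply]
    refine Prod.ext rfl ?_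
    funext σ J
    simp
  rw [h3, covectorWedgeIter_compLinearMap] at h2
  exact h2

end IntegralElements

/-! ### Contraction with generic powers -/

section GenericContraction

open MvPolynomial

variable {n m r : ℕ}

/-- Alternating forms on the coordinate space with values in the polynomials in the components of
generic covectors. -/
abbrev JetPolyForm (n m r p : ℕ) : Type :=
  (JetCoord n m r) [⋀^Fin p]→ₗ[ℝ] MvPolynomial (ℕ × Fin n) ℝ

/-- The monomial `λ_j^J`. -/
def genericMonomial (j : ℕ) (J : Multiset (Fin n)) : MvPolynomial (ℕ × Fin n) ℝ :=
  (J.map fun i => X (j, i)).prod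

theorem pderiv_genericMonomial_of_ne {j l : ℕ} (h : l ≠ j) (i : Fin n) (J : Multiset (Fin n)) :
    pderiv (l, i) (genericMonomial j J) = 0 := by
  induction J using Multiset.induction_on with
  | empty => simp [genericMonomial]
  | cons a J ih =>
    rw [genericMonomial, Multiset.map_cons, Multiset.prod_cons, ← genericMonomial,
      Derivation.leibniz, ih, pderiv_X_of_ne (by simp [Ne.symm h])]
    simp

theorem pderiv_genericMonomial (j : ℕ) (i : Fin n) (J : Multiset (Fin n)) :
    pderiv (j, i) (genericMonomial j J) = (J.count i : ℝ) • genericMonomial j (J.erase i) := by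
  induction J using Multiset.induction_on with
  | empty => simp [genericMonomial]
  | cons a J ih =>
    rw [genericMonomial, Multiset.map_cons, Multiset.prod_cons, ← genericMonomial,
      Derivation.leibniz, ih]
    by_cases h : i = a
    · subst h
      rw [pderiv_X_self, Multiset.erase_cons_head, Multiset.count_cons_self]
      by_cases hi : i ∈ J
      · conv_rhs => rw [← Multiset.cons_erase hi]
        conv_lhs => rw [← Multiset.cons_erase hi]
        simp only [genericMonomial, Multiset.map_cons, Multiset.prod_cons, smul_eq_mul,
          Multiset.erase_cons_head, Multiset.count_cons_self, Nat.cast_add, Nat.cast_one, add_smul,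
          one_smul, mul_one, MvPolynomial.smul_eq_C_mul]
        ring
      · simp [Multiset.count_eq_zero_of_notMem hi]
    · rw [pderiv_X_of_ne (by simp [Ne.symm h]), Multiset.count_cons_of_ne h,
        Multiset.erase_cons_tail _ (Ne.symm h)]
      simp [genericMonomial]

theorem polarization_genericMonomial (j : ℕ) (J : Multiset (Fin n)) :
    polarization j j (genericMonomial j J) = (Multiset.card J : ℝ) • genericMonomial j J := by
  induction J using Multiset.induction_on with
  | empty => simp [genericMonomial]
  | cons a J ih =>
    rw [genericMonomial, Multiset.map_cons, Multiset.prod_cons, ← genericMonomial,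
      Derivation.leibniz, ih, polarization_X]
    simp only [if_true, smul_eq_mul, Multiset.card_cons, Nat.cast_add, Nat.cast_one, add_smul,
      one_smul, MvPolynomial.smul_eq_C_mul]
    ring

/-- The contraction `∑_{|J| = r} λ_j^J ι(∂/∂y^σ_J) β` with the power vector of a generic
covector. -/
def genericContract (j : ℕ) (σ : Fin m) {p : ℕ} (β : JetPolyForm n m r (p + 1)) :
    JetPolyForm n m r p :=
  ∑ J : MultiIndex n (r + 1) with Multiset.card J.1 = r,
    genericMonomial j J.1 • β.curryLeft (fibreVector σ J)

theorem genericContract_apply (j : ℕ) (σ : Fin m) {p : ℕ} (β : JetPolyForm n m r (p + 1))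
    (v : Fin p → JetCoord n m r) :
    genericContract j σ β v = ∑ J : MultiIndex n (r + 1) with Multiset.card J.1 = r,
      genericMonomial j J.1 * β (Matrix.vecCons (fibreVector σ J) v) := by
  rw [genericContract, alternatingMap_sum_apply]
  rfl

/-- The values of `β` do not involve `λ_j`. -/
def IsIndep (j : ℕ) {p : ℕ} (β : JetPolyForm n m r p) : Prop :=
  ∀ i v, pderiv (j, i) (β v) = 0

/-- The form `β` is homogeneous of degree `r` in `λ_j`. -/
def IsHomog (j : ℕ) {p : ℕ} (β : JetPolyForm n m r p) : Prop :=
  ∀ v, polarization j j (β v) = (r : ℝ) • β v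

/-- The divergence `∑ᵢ ∂/∂λ_{j,i} ι(∂/∂xⁱ) β` vanishes. -/
def IsJetDivFree (j : ℕ) {p : ℕ} (β : JetPolyForm n m r p) : Prop :=
  ∀ (v : Fin p → JetCoord n m r) (a : Fin p),
    ∑ i, pderiv (j, i) (β (Function.update v a (baseVector i))) = 0

/-- The contraction of `β` with `∑ᵢ (I(i) + 1) ∂/∂xⁱ ∧ ∂/∂y^σ_{iI}`, `|I| = r - 1`, vanishes. -/
def IsTraceFree {A : Type*} [CommRing A] [Algebra ℝ A] {p : ℕ}
    (β : (JetCoord n m r) [⋀^Fin p]→ₗ[ℝ] A) : Prop :=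
  ∀ (σ : Fin m) (I : MultiIndex n r), Multiset.card I.1 + 1 = r →
    ∀ (v : Fin p → JetCoord n m r) (a b : Fin p), a ≠ b →
      ∑ i, ((I.1.count i : ℝ) + 1) •
        β (Function.update (Function.update v a (baseVector i)) b (fibreVector σ (I.cons i))) = 0

theorem update_vecCons_succ {α : Type*} {p : ℕ} (x y : α) (v : Fin p → α) (a : Fin p) :
    Matrix.vecCons x (Function.update v a y) = Function.update (Matrix.vecCons x v) a.succ y :=
  Fin.cons_update (α := fun _ => α) x v a y

theorem update_vecCons_zero {α : Type*} {p : ℕ} (x y : α) (v : Fin p → α) :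
    Function.update (Matrix.vecCons x v) 0 y = Matrix.vecCons y v :=
  Fin.update_cons_zero (α := fun _ => α) x v y

theorem IsTraceFree.genericContract {j : ℕ} (σ : Fin m) {p : ℕ} {β : JetPolyForm n m r (p + 1)}
    (h : IsTraceFree β) : IsTraceFree (genericContract j σ β) := by
  intro τ I hI v a b hab
  simp only [genericContract_apply, Finset.smul_sum]
  rw [Finset.sum_comm]
  refine Finset.sum_eq_zero fun J _ => ?_
  have := h τ I hI (Matrix.vecCons (fibreVector σ J) v) a.succ b.succ (by simpa using hab)
  simp only [← update_vecCons_succ] at this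
  simp only [← mul_smul_comm, ← Finset.mul_sum, this, mul_zero]

theorem IsIndep.genericContract {j l : ℕ} (hl : l ≠ j) (σ : Fin m) {p : ℕ}
    {β : JetPolyForm n m r (p + 1)} (h : IsIndep l β) : IsIndep l (genericContract j σ β) := by
  intro i v
  rw [genericContract_apply, map_sum]
  refine Finset.sum_eq_zero fun J _ => ?_
  rw [Derivation.leibniz, h, pderiv_genericMonomial_of_ne hl]
  simp

theorem IsHomog.genericContract {j l : ℕ} (hl : l ≠ j) (σ : Fin m) {p : ℕ}
    {β : JetPolyForm n m r (p + 1)} (h : IsHomog l β) : IsHomog l (genericContract j σ β) := by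
  intro v
  rw [genericContract_apply, map_sum, Finset.smul_sum]
  refine Finset.sum_congr rfl fun J _ => ?_
  rw [Derivation.leibniz, h, polarization_apply l l (genericMonomial _ _)]
  simp [pderiv_genericMonomial_of_ne hl]

theorem IsIndep.isHomog_genericContract {j : ℕ} (σ : Fin m) {p : ℕ}
    {β : JetPolyForm n m r (p + 1)} (h : IsIndep j β) : IsHomog j (JetContact.genericContract j σ β) := by
  intro v
  rw [genericContract_apply, map_sum, Finset.smul_sum]
  refine Finset.sum_congr rfl fun J hJ => ?_
  rw [Derivation.leibniz, polarization_genericMonomial, (Finset.mem_filter.1 hJ).2,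
    polarization_apply j j (β _)]
  simp [h _ _, mul_comm]

theorem IsJetDivFree.genericContract {j l : ℕ} (hl : l ≠ j) (σ : Fin m) {p : ℕ}
    {β : JetPolyForm n m r (p + 1)} (h : IsJetDivFree l β) :
    IsJetDivFree l (genericContract j σ β) := by
  intro v a
  simp only [genericContract_apply, map_sum, Derivation.leibniz,
    pderiv_genericMonomial_of_ne hl, smul_eq_mul, mul_zero, add_zero]
  rw [Finset.sum_comm]
  refine Finset.sum_eq_zero fun J _ => ?_
  have := h (Matrix.vecCons (fibreVector σ J) v) a.succ
  simp only [← update_vecCons_succ] at this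
  rw [← Finset.mul_sum, this, mul_zero]

/-- Multi-indices of length `r` containing `i` correspond to multi-indices of length `r - 1`. -/
theorem sum_count_eq_sum_cons {N : Type*} [AddCommMonoid N] [Module ℝ N] (i : Fin n)
    (g : MultiIndex n (r + 1) → N) :
    ∑ J : MultiIndex n (r + 1) with Multiset.card J.1 = r, (J.1.count i : ℝ) • g J =
      ∑ I : MultiIndex n r with Multiset.card I.1 + 1 = r,
        ((I.1.count i : ℝ) + 1) • g (I.cons i) := by
  symm
  refine Finset.sum_of_injOn (fun I => I.cons i) ?_ ?_ ?_ ?_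
  · intro I _ I' _ h
    have := congrArg Subtype.val h
    exact Subtype.ext ((Multiset.cons_inj_right i).1 this)
  · intro I hI
    simpa [MultiIndex.cons] using hI
  · intro J hJ hJ'
    have hJr := (Finset.mem_filter.1 hJ).2
    by_cases hi : i ∈ J.1
    · refine absurd ?_ hJ'
      have hc := Multiset.card_erase_add_one hi
      exact ⟨⟨J.1.erase i, by omega⟩, by simp only [Finset.coe_filter, Finset.mem_univ, true_and, mem_ofPred_eq]; omega,
        Subtype.ext (Multiset.cons_erase hi)⟩
    · simp [Multiset.count_eq_zero_of_notMem hi]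
  · intro I _
    simp [MultiIndex.cons]

/-- Differentiating `λ_j^J` turns the sum over `|J| = r` into a sum over `|I| = r - 1` with the weights
`I(i) + 1`, so trace freeness becomes divergence freeness. -/
theorem IsTraceFree.isJetDivFree_genericContract {j : ℕ} (σ : Fin m) {p : ℕ}
    {β : JetPolyForm n m r (p + 1)} (h : IsTraceFree β) (hj : IsIndep j β) :
    IsJetDivFree j (JetContact.genericContract j σ β) := by
  intro v a
  have h1 : ∀ i, pderiv (j, i) (JetContact.genericContract j σ β (Function.update v a (baseVector i))) =
      ∑ I : MultiIndex n r with Multiset.card I.1 + 1 = r, ((I.1.count i : ℝ) + 1) •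
        (genericMonomial j I.1 *
          β (Matrix.vecCons (fibreVector σ (I.cons i)) (Function.update v a (baseVector i)))) := by
    intro i
    rw [genericContract_apply, map_sum]
    have h2 := sum_count_eq_sum_cons i (r := r) (fun J => genericMonomial j (J.1.erase i) *
      β (Matrix.vecCons (fibreVector σ J) (Function.update v a (baseVector i))))
    simp only [MultiIndex.cons, Multiset.erase_cons_head] at h2
    simp only [MultiIndex.cons]
    rw [← h2]
    refine Finset.sum_congr rfl fun J _ => ?_
    rw [Derivation.leibniz, hj, pderiv_genericMonomial]
    simp [mul_comm]
  simp only [h1]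
  rw [Finset.sum_comm]
  refine Finset.sum_eq_zero fun I hI => ?_
  have h3 := h σ I (Finset.mem_filter.1 hI).2 (Matrix.vecCons 0 v) a.succ 0 (Fin.succ_ne_zero a)
  simp only [← update_vecCons_succ, update_vecCons_zero] at h3
  simp only [← mul_smul_comm, ← Finset.mul_sum, h3, mul_zero]

/-- The contraction with the power vectors of the generic covectors `λ_{k-1}`, …, `λ₀`. -/
def genericContractIter (σ : ℕ → Fin m) {p : ℕ} :
    (k : ℕ) → JetPolyForm n m r (p + k) → JetPolyForm n m r p
  | 0, β => β
  | k + 1, β => genericContractIter σ k (genericContract k (σ k) β)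

theorem IsHomog.genericContractIter (σ : ℕ → Fin m) {p j k : ℕ} (hk : k ≤ j) :
    ∀ {β : JetPolyForm n m r (p + k)}, IsHomog j β → IsHomog j (genericContractIter σ k β) := by
  induction k with
  | zero => exact fun h => h
  | succ k ih => exact fun h => ih (by omega) (h.genericContract (by omega) _)

theorem IsJetDivFree.genericContractIter (σ : ℕ → Fin m) {p j k : ℕ} (hk : k ≤ j) :
    ∀ {β : JetPolyForm n m r (p + k)}, IsJetDivFree j β →
      IsJetDivFree j (genericContractIter σ k β) := by
  induction k with
  | zero => exact fun h => h
  | succ k ih => exact fun h => ih (by omega) (h.genericContract (by omega) _)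

theorem isHomog_genericContractIter (σ : ℕ → Fin m) {p k : ℕ} :
    ∀ {β : JetPolyForm n m r (p + k)}, (∀ j < k, IsIndep j β) →
      ∀ j < k, IsHomog j (genericContractIter σ k β) := by
  induction k with
  | zero => intro _ _ j hj; omega
  | succ k ih =>
    intro β h j hj
    rcases Nat.lt_succ_iff_lt_or_eq.1 hj with hjk | rfl
    · exact ih (fun s hs => (h s (by omega)).genericContract (by omega) _) j hjk
    · exact ((h j hj).isHomog_genericContract (σ j)).genericContractIter σ le_rfl

theorem isJetDivFree_genericContractIter (σ : ℕ → Fin m) {p k : ℕ} :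
    ∀ {β : JetPolyForm n m r (p + k)}, IsTraceFree β → (∀ j < k, IsIndep j β) →
      ∀ j < k, IsJetDivFree j (genericContractIter σ k β) := by
  induction k with
  | zero => intro _ _ _ j hj; omega
  | succ k ih =>
    intro β ht h j hj
    rcases Nat.lt_succ_iff_lt_or_eq.1 hj with hjk | rfl
    · exact ih (ht.genericContract _) (fun s hs => (h s (by omega)).genericContract (by omega) _)
        j hjk
    · exact (ht.isJetDivFree_genericContract (σ j) (h j hj)).genericContractIter σ le_rfl

/-- The evaluation of the generic covectors at actual covectors. -/
def evalCovectors (l : ℕ → Fin n → ℝ) : MvPolynomial (ℕ × Fin n) ℝ →ₐ[ℝ] ℝ :=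
  aeval fun c => l c.1 c.2

theorem eval_covectorWedge {M : Type*} [AddCommGroup M] [Module ℝ M] (l : ℕ → Fin n → ℝ) {p : ℕ}
    (θ : M →ₗ[ℝ] MvPolynomial (ℕ × Fin n) ℝ) (F : M [⋀^Fin p]→ₗ[ℝ] MvPolynomial (ℕ × Fin n) ℝ) :
    (evalCovectors l).toLinearMap.compAlternatingMap (covectorWedge θ F) =
      covectorWedge ((evalCovectors l).toLinearMap ∘ₗ θ)
        ((evalCovectors l).toLinearMap.compAlternatingMap F) := by
  refine AlternatingMap.ext fun v => ?_
  simp only [LinearMap.compAlternatingMap_apply, covectorWedge_apply, map_sum,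
    AlgHom.toLinearMap_apply, map_mul, map_pow, map_neg, map_one, LinearMap.comp_apply]

theorem eval_wedgeGenericIter (l : ℕ → Fin n → ℝ) {p : ℕ} (k : ℕ) (F : PolyForm n p) :
    (evalCovectors l).toLinearMap.compAlternatingMap (wedgeGenericIter k F) =
      covectorWedgeIter (fun j => covector (l j)) k
        ((evalCovectors l).toLinearMap.compAlternatingMap F) := by
  induction k with
  | zero => rfl
  | succ k ih =>
    rw [wedgeGenericIter, eval_covectorWedge, ih, covectorWedgeIter]
    congr 1
    refine LinearMap.ext fun v => ?_
    simp [genericCovector_apply, covector_apply, evalCovectors, mul_comm]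

theorem eval_genericContractIter (l : ℕ → Fin n → ℝ) (σ : ℕ → Fin m) {p : ℕ} (k : ℕ) :
    ∀ β : JetPolyForm n m r (p + k),
      (evalCovectors l).toLinearMap.compAlternatingMap (genericContractIter σ k β) =
        contractIter σ l k ((evalCovectors l).toLinearMap.compAlternatingMap β) := by
  induction k with
  | zero => exact fun _ => rfl
  | succ k ih =>
    intro β
    rw [genericContractIter, ih, contractIter]
    congr 1
    refine AlternatingMap.ext fun v => ?_
    simp only [LinearMap.compAlternatingMap_apply, genericContract_apply, map_sum, powerVector,
      alternatingMap_sum_apply, map_smul, AlternatingMap.smul_apply,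
      AlternatingMap.curryLeft_apply_apply, AlgHom.toLinearMap_apply, map_mul, smul_eq_mul]
    refine Finset.sum_congr rfl fun J _ => ?_
    congr 1
    simp [genericMonomial, evalCovectors, map_multiset_prod]

/-- A trace free form vanishing on all integral elements vanishes on `p` horizontal vectors and
`k` power vectors, if `p + k ≤ n`. -/
theorem contractIter_eq_zero {p k : ℕ} (hpk : p + k ≤ n)
    {α : (JetCoord n m r) [⋀^Fin (p + k)]→ₗ[ℝ] ℝ} (ht : IsTraceFree α)
    (hα : ∀ a, α.compLinearMap (integralElement r a) = 0) (σ : ℕ → Fin m) (l : ℕ → Fin n → ℝ) :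
    (contractIter σ l k α).compLinearMap (LinearMap.inl ℝ _ _) = 0 := by
  let β : JetPolyForm n m r (p + k) :=
    (Algebra.linearMap ℝ (MvPolynomial (ℕ × Fin n) ℝ)).compAlternatingMap α
  have hβ : ∀ l', (evalCovectors l').toLinearMap.compAlternatingMap β = α := by
    intro l'
    refine AlternatingMap.ext fun v => ?_
    simp [β, evalCovectors]
  have hi : ∀ j < k, IsIndep j β := by
    intro j _ i v
    simp [β, MvPolynomial.algebraMap_eq]
  have htβ : IsTraceFree β := by
    intro τ I hI v a b hab
    have := congrArg (Algebra.linearMap ℝ (MvPolynomial (ℕ × Fin n) ℝ)) (ht τ I hI v a b hab)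
    rw [map_sum, map_zero] at this
    rw [← this]
    exact Finset.sum_congr rfl fun i _ => by rw [map_smul]; rfl
  let F : PolyForm n p := (genericContractIter σ k β).compLinearMap (LinearMap.inl ℝ _ _)
  have hF : F = 0 := by
    refine eq_zero_of_wedgeGenericIter_eq_zero hpk _ (fun _ => r) F rfl ?_ ?_ ?_
    · intro j hj
      refine AlternatingMap.ext fun v => ?_
      exact isHomog_genericContractIter σ hi j hj _
    · intro j hj
      have h := isJetDivFree_genericContractIter σ htβ hi j hj
      cases p with
      | zero => trivial
      | succ p =>
        refine AlternatingMap.ext fun v => ?_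
        rw [divergence_apply]
        have := h (Matrix.vecCons 0 fun i => LinearMap.inl ℝ _ _ (v i)) 0
        simp only [update_vecCons_zero] at this
        rw [AlternatingMap.zero_apply, ← this]
        refine Finset.sum_congr rfl fun i _ => ?_
        congr 1
        simp only [F, AlternatingMap.compLinearMap_apply]
        congr 1
        funext s
        refine Fin.cases ?_ (fun s => ?_) s <;> rfl
    -- a polynomial vanishes if it vanishes at all real values `x` of the generic covectors
    · refine AlternatingMap.ext fun v => ?_
      refine MvPolynomial.funext fun x => ?_
      have h1 := eval_wedgeGenericIter (fun j i => x (j, i)) k F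
      have h2 : (evalCovectors fun j i => x (j, i)).toLinearMap.compAlternatingMap F =
          (contractIter σ (fun j i => x (j, i)) k α).compLinearMap (LinearMap.inl ℝ _ _) := by
        conv_rhs => rw [← hβ fun j i => x (j, i)]
        rw [← eval_genericContractIter]
        rfl
      rw [h2, covectorWedgeIter_contractIter_eq_zero σ _ k hα] at h1
      have h3 := congrArg (fun G => G v) h1
      rw [← MvPolynomial.coe_aeval_eq_eval]
      exact h3.trans (map_zero _).symm
  have h4 := eval_genericContractIter l σ k β
  rw [hβ] at h4
  rw [← h4]
  have h5 := congrArg (fun G : PolyForm n p =>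
    (evalCovectors l).toLinearMap.compAlternatingMap G) hF
  refine Eq.trans ?_ (h5.trans ?_)
  · rfl
  · refine AlternatingMap.ext fun v => ?_
    simp

end GenericContraction

/-! ### Trace free forms vanishing on integral elements -/

section TraceFree

variable {n m r : ℕ}

theorem contractIter_congr {σ σ' : ℕ → Fin m} {l l' : ℕ → Fin n → ℝ} {p k : ℕ}
    (h : ∀ j < k, σ j = σ' j ∧ l j = l' j) (α : (JetCoord n m r) [⋀^Fin (p + k)]→ₗ[ℝ] ℝ) :
    contractIter σ l k α = contractIter σ' l' k α := by
  induction k with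
  | zero => rfl
  | succ k ih =>
    simp only [contractIter]
    rw [(h k (by omega)).1, (h k (by omega)).2, ih fun j hj => h j (by omega)]

/-- The form vanishes on all tuples consisting of power vectors followed by horizontal vectors. -/
def VanishesOnPowers : {q : ℕ} → (JetCoord n m r) [⋀^Fin q]→ₗ[ℝ] ℝ → Prop
  | 0, α => α.compLinearMap (LinearMap.inl ℝ _ _) = 0
  | _ + 1, α => α.compLinearMap (LinearMap.inl ℝ _ _) = 0 ∧
      ∀ σ l, VanishesOnPowers (α.curryLeft (powerVector r σ l))

theorem VanishesOnPowers.horizontal {q : ℕ} {α : (JetCoord n m r) [⋀^Fin q]→ₗ[ℝ] ℝ}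
    (h : VanishesOnPowers α) : α.compLinearMap (LinearMap.inl ℝ _ _) = 0 := by
  cases q with
  | zero => exact h
  | succ q => exact h.1

theorem VanishesOnPowers.neg {q : ℕ} :
    ∀ {α : (JetCoord n m r) [⋀^Fin q]→ₗ[ℝ] ℝ}, VanishesOnPowers α → VanishesOnPowers (-α) := by
  have h0 : ∀ {q : ℕ} {α : (JetCoord n m r) [⋀^Fin q]→ₗ[ℝ] ℝ},
      α.compLinearMap (LinearMap.inl ℝ _ _) = 0 → (-α).compLinearMap (LinearMap.inl ℝ _ _) = 0 := by
    intro q α h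
    change -(α.compLinearMap (LinearMap.inl ℝ _ _)) = 0
    rw [h, neg_zero]
  induction q with
  | zero => exact fun h => h0 h
  | succ q ih => exact fun h => ⟨h0 h.1, fun σ l => ih (h.2 σ l)⟩

theorem VanishesOnPowers.curryLeft_horizontal (x : Fin n → ℝ) {q : ℕ} :
    ∀ {α : (JetCoord n m r) [⋀^Fin (q + 1)]→ₗ[ℝ] ℝ}, VanishesOnPowers α →
      VanishesOnPowers (α.curryLeft (LinearMap.inl ℝ _ _ x)) := by
  have h0 : ∀ {q : ℕ} {α : (JetCoord n m r) [⋀^Fin (q + 1)]→ₗ[ℝ] ℝ},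
      α.compLinearMap (LinearMap.inl ℝ _ _) = 0 →
        (α.curryLeft (LinearMap.inl ℝ _ _ x)).compLinearMap (LinearMap.inl ℝ _ _) = 0 := by
    intro q α h
    rw [← AlternatingMap.curryLeft_compLinearMap, h]
    rfl
  induction q with
  | zero => exact fun h => h0 h.1
  | succ q ih =>
    intro α h
    refine ⟨h0 h.1, fun σ l => ?_⟩
    rw [curryLeft_curryLeft_swap]
    exact (ih (h.2 σ l)).neg

theorem vanishesOnPowers_of_contractIter {q : ℕ} :
    ∀ {α : (JetCoord n m r) [⋀^Fin q]→ₗ[ℝ] ℝ},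
      (∀ (p k : ℕ) (h : q = p + k) (σ : ℕ → Fin m) (l : ℕ → Fin n → ℝ),
        (contractIter σ l k (α.domDomCongr (finCongr h))).compLinearMap
          (LinearMap.inl ℝ _ _) = 0) → α.compLinearMap (LinearMap.inl ℝ _ _) = 0 →
      VanishesOnPowers α := by
  induction q with
  | zero => exact fun _ h => h
  | succ q ih =>
    refine fun {α} h h0 => ⟨h0, fun τ t => ih ?_ ?_⟩
    · rintro p k rfl σ l
      have h1 := h p (k + 1) rfl (Function.update σ k τ) (Function.update l k t)
      rw [contractIter, Function.update_self, Function.update_self] at h1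
      rw [contractIter_congr (σ' := σ) (l' := l)] at h1
      · exact h1
      · intro j hj
        simp [hj.ne]
    · have h1 := h q 1 rfl (fun _ => τ) (fun _ => t)
      exact h1

/-- Powers of covectors span the homogeneous polynomials of degree `r`; equivalently, a polynomial
function vanishing at all real points has zero coefficients. -/
theorem eq_zero_of_forall_sum_power {N : Type*} (f : MultiIndex n (r + 1) → N → ℝ)
    (h : ∀ l : Fin n → ℝ, ∀ v, ∑ J : MultiIndex n (r + 1) with Multiset.card J.1 = r,
      (J.1.map l).prod * f J v = 0) (J : MultiIndex n (r + 1)) (hJ : Multiset.card J.1 = r) (v : N) :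
    f J v = 0 := by
  classical
  let P : MvPolynomial (Fin n) ℝ := ∑ J : MultiIndex n (r + 1) with Multiset.card J.1 = r,
    MvPolynomial.monomial (Multiset.toFinsupp J.1) (f J v)
  have hP : P = 0 := by
    refine MvPolynomial.funext fun l => ?_
    rw [map_zero, ← h l v, map_sum]
    refine Finset.sum_congr rfl fun J _ => ?_
    rw [MvPolynomial.eval_monomial, mul_comm]
    congr 1
    rw [Finset.prod_multiset_map_count, Finsupp.prod, Multiset.toFinsupp_support]
    simp
  have h1 := congrArg (MvPolynomial.coeff (Multiset.toFinsupp J.1)) hP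
  rw [MvPolynomial.coeff_zero, MvPolynomial.coeff_sum,
    Finset.sum_eq_single J] at h1
  · simpa using h1
  · intro K _ hK
    rw [MvPolynomial.coeff_monomial, if_neg]
    exact fun h => hK (Subtype.ext (Multiset.toFinsupp.injective h))
  · intro hJ'
    exact absurd (by simpa using hJ) hJ'

theorem jetCoord_eq_sum (p : JetCoord n m r) :
    p = LinearMap.inl ℝ _ _ p.1 + ∑ σ, ∑ J, p.2 σ J • fibreVector σ J := by
  refine Prod.ext ?_ ?_
  · simp [fibreVector, Prod.fst_sum]
  · funext τ K
    have h : ∀ x : JetCoord n m r, x.2 τ K = dy τ K x := fun _ => rfl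
    rw [h (_ + _)]
    simp only [map_add, map_sum, map_smul, dy_fibreVector]
    rw [Finset.sum_eq_single τ (fun σ _ hσ => by simp [Ne.symm hσ]) (by simp),
      Finset.sum_eq_single K (fun J _ hJ => by simp [Ne.symm hJ]) (by simp)]
    simp [dy]

/-- Power vectors span the directions `∂/∂y^σ_J` with `|J| = r`. -/
theorem VanishesOnPowers.eq_zero {q : ℕ} :
    ∀ {α : (JetCoord n m r) [⋀^Fin q]→ₗ[ℝ] ℝ}, VanishesOnPowers α →
      (∀ (v : Fin q → JetCoord n m r) (a : Fin q) (σ : Fin m) (J : MultiIndex n (r + 1)),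
        Multiset.card J.1 < r → α (Function.update v a (fibreVector σ J)) = 0) → α = 0 := by
  induction q with
  | zero =>
    intro α h _
    refine AlternatingMap.ext fun v => ?_
    have h1 := congrArg (fun G : (Fin n → ℝ) [⋀^Fin 0]→ₗ[ℝ] ℝ => G 0) h.horizontal
    rw [Subsingleton.elim v (fun i => LinearMap.inl ℝ _ _ ((0 : Fin 0 → Fin n → ℝ) i))]
    exact h1
  | succ q ih =>
    intro α h h1
    have hsub : ∀ (u : JetCoord n m r) (v : Fin q → JetCoord n m r) (a : Fin q) (σ : Fin m)
        (J : MultiIndex n (r + 1)), Multiset.card J.1 < r →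
          α.curryLeft u (Function.update v a (fibreVector σ J)) = 0 := by
      intro u v a σ J hJ
      rw [AlternatingMap.curryLeft_apply_apply, update_vecCons_succ]
      exact h1 _ _ _ _ hJ
    have hx : ∀ x, α.curryLeft (LinearMap.inl ℝ _ _ x) = 0 := fun x =>
      ih (h.curryLeft_horizontal x) (hsub _)
    have hp : ∀ σ l, α.curryLeft (powerVector r σ l) = 0 := fun σ l => ih (h.2 σ l) (hsub _)
    have hy : ∀ σ J, α.curryLeft (fibreVector σ J) = 0 := by
      intro σ J
      refine AlternatingMap.ext fun v => ?_
      rcases Nat.lt_succ_iff_lt_or_eq.1 J.2 with hJ | hJ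
      · have := h1 (Matrix.vecCons 0 v) 0 σ J hJ
        rwa [update_vecCons_zero] at this
      · refine eq_zero_of_forall_sum_power (fun J v => α.curryLeft (fibreVector σ J) v) ?_ J hJ v
        intro l v
        have := congrArg (fun G => G v) (hp σ l)
        simpa only [powerVector, map_sum, map_smul, alternatingMap_sum_apply,
          AlternatingMap.smul_apply, AlternatingMap.zero_apply, smul_eq_mul] using this
    refine AlternatingMap.ext fun v => ?_
    obtain ⟨w, t, rfl⟩ : ∃ w t, v = Matrix.vecCons w t :=
      ⟨v 0, fun i => v i.succ, by funext i; refine Fin.cases ?_ (fun i => ?_) i <;> rfl⟩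
    rw [← AlternatingMap.curryLeft_apply_apply, jetCoord_eq_sum w]
    simp only [map_add, map_sum, map_smul, hx, hy, smul_zero, Finset.sum_const_zero, add_zero,
      AlternatingMap.zero_apply]

/-- A trace free form of degree `q ≤ n` without components along `∂/∂y^σ_J`, `|J| < r`, which
vanishes on all integral elements is zero. -/
theorem eq_zero_of_isTraceFree {q : ℕ} (hq : q ≤ n) {α : (JetCoord n m r) [⋀^Fin q]→ₗ[ℝ] ℝ}
    (h1 : ∀ (v : Fin q → JetCoord n m r) (a : Fin q) (σ : Fin m) (J : MultiIndex n (r + 1)),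
      Multiset.card J.1 < r → α (Function.update v a (fibreVector σ J)) = 0)
    (ht : IsTraceFree α) (hα : ∀ a, α.compLinearMap (integralElement r a) = 0) : α = 0 := by
  have hc : ∀ (p k : ℕ) (h : q = p + k) (σ : ℕ → Fin m) (l : ℕ → Fin n → ℝ),
      (contractIter σ l k (α.domDomCongr (finCongr h))).compLinearMap (LinearMap.inl ℝ _ _) = 0 := by
    intro p k h σ l
    subst h
    exact contractIter_eq_zero hq ht hα σ l
  refine (vanishesOnPowers_of_contractIter hc ?_).eq_zero h1
  have := hα 0
  have h3 : integralElement r (0 : Fin m → Multiset (Fin n) → ℝ) = LinearMap.inl ℝ _ _ := by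
    refine LinearMap.ext fun v => ?_
    rw [integralElement_apply]
    refine Prod.ext rfl ?_
    funext σ J
    simp
  rwa [h3] at this

end TraceFree

/-! ### Properties of the wedge product -/

section WedgeProperties

variable {E E' : Type*} [NormedAddCommGroup E] [NormedSpace ℝ E] [NormedAddCommGroup E']
  [NormedSpace ℝ E'] {p l k : ℕ}

theorem wedge_apply (h : p + l = k) (α : E [⋀^Fin p]→L[ℝ] ℝ) (β : E [⋀^Fin l]→L[ℝ] ℝ)
    (v : Fin k → E) :
    wedge h α β v = sumWedge α β fun i => v (finSumFinEquiv.trans (finCongr h) i) := rfl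

theorem sumWedge_eq (α : E [⋀^Fin p]→L[ℝ] ℝ) (β : E [⋀^Fin l]→L[ℝ] ℝ) :
    sumWedge α β = (LinearMap.mul' ℝ ℝ).compAlternatingMap
      (AlternatingMap.domCoprod' (α.toAlternatingMap ⊗ₜ[ℝ] β.toAlternatingMap)) := rfl

theorem wedge_add_right (h : p + l = k) (α : E [⋀^Fin p]→L[ℝ] ℝ) (β β' : E [⋀^Fin l]→L[ℝ] ℝ) :
    wedge h α (β + β') = wedge h α β + wedge h α β' := by
  ext v
  have : (β + β').toAlternatingMap = β.toAlternatingMap + β'.toAlternatingMap := rfl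
  simp [wedge_apply, sumWedge_eq, this, TensorProduct.tmul_add]

theorem wedge_smul_right (h : p + l = k) (α : E [⋀^Fin p]→L[ℝ] ℝ) (c : ℝ)
    (β : E [⋀^Fin l]→L[ℝ] ℝ) : wedge h α (c • β) = c • wedge h α β := by
  ext v
  have : (c • β).toAlternatingMap = c • β.toAlternatingMap := rfl
  simp [wedge_apply, sumWedge_eq, this, TensorProduct.tmul_smul]

theorem wedge_zero_left (h : p + l = k) (β : E [⋀^Fin l]→L[ℝ] ℝ) :
    wedge h (0 : E [⋀^Fin p]→L[ℝ] ℝ) β = 0 := by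
  ext v
  have : (0 : E [⋀^Fin p]→L[ℝ] ℝ).toAlternatingMap = 0 := rfl
  simp [wedge_apply, sumWedge_eq, this, TensorProduct.zero_tmul]

theorem wedge_compContinuousLinearMap (h : p + l = k) (α : E [⋀^Fin p]→L[ℝ] ℝ)
    (β : E [⋀^Fin l]→L[ℝ] ℝ) (A : E' →L[ℝ] E) :
    (wedge h α β).compContinuousLinearMap A =
      wedge h (α.compContinuousLinearMap A) (β.compContinuousLinearMap A) := by
  ext v
  rw [ContinuousAlternatingMap.compContinuousLinearMap_apply, wedge_apply, wedge_apply]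
  simp only [sumWedge, LinearMap.compAlternatingMap_apply, AlternatingMap.domCoprod_apply,
    sum_apply, map_sum]
  refine Finset.sum_congr rfl fun s _ => ?_
  induction s using Quotient.inductionOn' with
  | _ s =>
    simp only [AlternatingMap.domCoprod.summand_mk'', smul_apply,
      MultilinearMap.domDomCongr_apply, MultilinearMap.domCoprod_apply]
    rfl

/-- The wedge product as an alternating sum over all permutations. -/
theorem factorial_mul_sumWedge (α : E [⋀^Fin p]→L[ℝ] ℝ) (β : E [⋀^Fin l]→L[ℝ] ℝ)
    (v : Fin p ⊕ Fin l → E) :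
    (p.factorial * l.factorial : ℝ) * sumWedge α β v =
      ∑ s : Equiv.Perm (Fin p ⊕ Fin l), (Equiv.Perm.sign s : ℝ) *
        ((α fun i => v (s (Sum.inl i))) * β fun i => v (s (Sum.inr i))) := by
  have h := MultilinearMap.domCoprod_alternization_eq α.toAlternatingMap β.toAlternatingMap
  have h1 := congrArg (fun G => LinearMap.mul' ℝ ℝ (G v)) h
  simp only [Fintype.card_fin, AlternatingMap.smul_apply] at h1
  rw [map_nsmul, nsmul_eq_mul, Nat.cast_mul] at h1
  refine h1.symm.trans ?_
  rw [MultilinearMap.alternatization_apply, map_sum]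
  refine Finset.sum_congr rfl fun s _ => ?_
  rcases Int.units_eq_one_or (Equiv.Perm.sign s) with h3 | h3 <;> simp [h3]

/-- Pairing of a wedge product with an alternating form, in terms of their values on the tuples
of vectors of a finite family `b`. -/
theorem sum_wedge_mul (h : p + l = k) {ι : Type*} [Fintype ι] (b : ι → E)
    (α : E [⋀^Fin p]→L[ℝ] ℝ) (β : E [⋀^Fin l]→L[ℝ] ℝ) (γ : E [⋀^Fin k]→L[ℝ] ℝ) :
    (p.factorial * l.factorial : ℝ) *
        ∑ t : Fin k → ι, wedge h α β (fun i => b (t i)) * γ (fun i => b (t i)) =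
      (k.factorial : ℝ) * ∑ t₂ : Fin l → ι, ∑ t₁ : Fin p → ι,
        (α fun i => b (t₁ i)) * (β fun i => b (t₂ i)) *
          γ fun i => b (Sum.elim t₁ t₂ ((finSumFinEquiv.trans (finCongr h)).symm i)) := by
  classical
  set e := finSumFinEquiv.trans (finCongr h) with he
  have h1 : ∀ s : Equiv.Perm (Fin p ⊕ Fin l), ∀ t : Fin p ⊕ Fin l → ι,
      γ (fun i => b (t (e.symm i))) =
        (Equiv.Perm.sign s : ℝ) * γ (fun i => b (t (s (e.symm i)))) := by
    intro s t
    have h2 := γ.toAlternatingMap.map_perm (fun i => b (t (e.symm i))) (e.permCongr s)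
    have h3 : ((fun i => b (t (e.symm i))) ∘ (e.permCongr s)) =
        fun i => b (t (s (e.symm i))) := by
      funext i; simp
    rw [h3, Equiv.Perm.sign_permCongr] at h2
    change γ (fun i => b (t (s (e.symm i)))) = _ • γ (fun i => b (t (e.symm i))) at h2
    rw [h2]
    rcases Int.units_eq_one_or (Equiv.Perm.sign s) with h3 | h3 <;> simp [h3]
  have h4 : ∑ t : Fin k → ι, wedge h α β (fun i => b (t i)) * γ (fun i => b (t i)) =
      ∑ t : Fin p ⊕ Fin l → ι, sumWedge α β (fun i => b (t i)) *
        γ (fun i => b (t (e.symm i))) := by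
    refine Fintype.sum_equiv (e.symm.arrowCongr (Equiv.refl ι)) _ _ fun t => ?_
    rw [wedge_apply]
    simp [he]
  rw [h4, Finset.mul_sum]
  simp only [← mul_assoc, factorial_mul_sumWedge, Finset.sum_mul]
  rw [Finset.sum_comm]
  have h5 : ∀ s : Equiv.Perm (Fin p ⊕ Fin l), ∑ t : Fin p ⊕ Fin l → ι,
      (Equiv.Perm.sign s : ℝ) * (α fun i => b (t (s (Sum.inl i)))) *
        (β fun i => b (t (s (Sum.inr i)))) * γ (fun i => b (t (e.symm i))) =
      ∑ t : Fin p ⊕ Fin l → ι, (α fun i => b (t (Sum.inl i))) *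
        (β fun i => b (t (Sum.inr i))) * γ (fun i => b (t (e.symm i))) := by
    intro s
    refine Fintype.sum_equiv (s.symm.arrowCongr (Equiv.refl ι)) _ _ fun t => ?_
    rw [h1 s t]
    rcases Int.units_eq_one_or (Equiv.Perm.sign s) with h3 | h3 <;> simp [h3, Function.comp_def]
  rw [Finset.sum_congr rfl fun s _ => h5 s, Finset.sum_const, Finset.card_univ, Fintype.card_perm,
    Fintype.card_sum, Fintype.card_fin, Fintype.card_fin, h, nsmul_eq_mul]
  congr 1
  rw [Finset.sum_comm, ← Fintype.sum_prod_type' (f := fun (t₁ : Fin p → ι) (t₂ : Fin l → ι) =>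
    (α fun i => b (t₁ i)) * (β fun i => b (t₂ i)) * γ fun i => b (Sum.elim t₁ t₂ (e.symm i)))]
  refine Fintype.sum_equiv (Equiv.sumArrowEquivProdArrow _ _ _) _ _ fun t => ?_
  have h6 : ∀ x, t x = Sum.elim (fun i => t (Sum.inl i)) (fun i => t (Sum.inr i)) x := by
    rintro (x | x) <;> rfl
  congr 2
  funext i
  rw [h6]
  rfl

theorem eq_zero_of_apply_eq_zero {ι : Type*} {b : ι → E} (hb : Submodule.span ℝ (range b) = ⊤) :
    ∀ {γ : E [⋀^Fin k]→ₗ[ℝ] ℝ}, (∀ t : Fin k → ι, γ (fun i => b (t i)) = 0) → γ = 0 := by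
  induction k with
  | zero =>
    intro γ h
    refine AlternatingMap.ext fun v => ?_
    rw [Subsingleton.elim v (fun i => b (Fin.elim0 i))]
    exact h _
  | succ k ih =>
    intro γ h
    have h1 : γ.curryLeft = 0 := by
      refine LinearMap.ext_on hb ?_
      rintro _ ⟨i, rfl⟩
      refine ih fun t => ?_
      rw [AlternatingMap.curryLeft_apply_apply, ← h (Fin.cons i t)]
      congr 1
      funext s
      refine Fin.cases ?_ (fun s => ?_) s <;> rfl
    refine AlternatingMap.ext fun v => ?_
    have h2 := congrArg (fun G => G (v 0) (fun i => v i.succ)) h1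
    refine Eq.trans ?_ h2
    rw [AlternatingMap.curryLeft_apply_apply]
    congr 1
    funext s
    refine Fin.cases ?_ (fun s => ?_) s <;> rfl

end WedgeProperties

/-! ### The basic contact forms at a point -/

section ContactSum

variable {n m r : ℕ}

/-- The constant form `dy^σ_J`. -/
def dyForm (σ : Fin m) (J : MultiIndex n (r + 1)) : (JetCoord n m r) [⋀^Fin 1]→L[ℝ] ℝ :=
  ContinuousAlternatingMap.ofSubsingleton ℝ (JetCoord n m r) ℝ (0 : Fin 1) (dy σ J)

theorem omega_apply (σ : Fin m) (J : MultiIndex n r) (p : JetCoord n m r)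
    (v : Fin 1 → JetCoord n m r) :
    omega σ J p v = (v 0).2 σ J.incl - ∑ i, p.2 σ (J.cons i) * (v 0).1 i := by
  change (dy σ J.incl - ∑ i : Fin n, p.2 σ (J.cons i) • dx i : JetCoord n m r →L[ℝ] ℝ) (v 0) = _
  simp only [sub_apply, sum_apply, smul_apply]
  rfl

theorem contDiff_omega (σ : Fin m) (J : MultiIndex n r) :
    ContDiff ℝ ∞ (omega σ J : CoordForm n m r 1) := by
  refine (ContinuousAlternatingMap.ofSubsingletonLIE (𝕜 := ℝ) (E := JetCoord n m r) (F := ℝ)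
    (0 : Fin 1)).toContinuousLinearEquiv.contDiff.comp ?_
  refine contDiff_const.sub (ContDiff.sum fun i _ => ?_)
  exact (dy σ (J.cons i)).contDiff.smul contDiff_const

/-- `dω^σ_J = -∑ᵢ dy^σ_{iJ} ∧ dxⁱ`. -/
theorem extDeriv_omega_apply (σ : Fin m) (J : MultiIndex n r) (p : JetCoord n m r)
    (v : Fin 2 → JetCoord n m r) :
    extDeriv (omega σ J) p v =
      ∑ i, ((v 1).2 σ (J.cons i) * (v 0).1 i - (v 0).2 σ (J.cons i) * (v 1).1 i) := by
  rw [extDeriv_apply ((contDiff_omega σ J).differentiable (by simp) p)]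
  have h : ∀ (w : Fin 1 → JetCoord n m r) (u : JetCoord n m r),
      fderiv ℝ (fun x => omega σ J x w) p u = -∑ i, u.2 σ (J.cons i) * (w 0).1 i := by
    intro w u
    have h1 : HasFDerivAt (fun x : JetCoord n m r => omega σ J x w)
        (0 - ∑ i, (w 0).1 i • dy σ (J.cons i)) p := by
      have h2 : (fun x : JetCoord n m r => omega σ J x w) =
          fun x => (w 0).2 σ J.incl - ∑ i, (w 0).1 i • dy σ (J.cons i) x := by
        funext x
        rw [omega_apply]
        congr 1
        exact Finset.sum_congr rfl fun i _ => mul_comm _ _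
      rw [h2]
      refine (hasFDerivAt_const _ _).sub (HasFDerivAt.fun_sum fun i _ => ?_)
      exact (dy σ (J.cons i)).hasFDerivAt.const_smul ((w 0).1 i)
    rw [h1.fderiv]
    simp only [zero_sub, neg_apply, sum_apply, smul_apply, smul_eq_mul]
    congr 1
    exact Finset.sum_congr rfl fun i _ => mul_comm _ _
  rw [Fin.sum_univ_two, h, h, Finset.sum_sub_distrib]
  simp [Fin.removeNth]
  ring

/-- The map `(Φ, Ψ) ↦ ∑ dy^σ_J ∧ Φ^J_σ + ∑_{|I| = r - 1} dω^σ_I ∧ Ψ^I_σ`. The form `dω^σ_I` is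
constant; its value is taken at the origin. -/
def contactSum (n m r : ℕ) {q : ℕ} (hq : 2 ≤ q) :
    ((Fin m → MultiIndex n r → (JetCoord n m r) [⋀^Fin (q - 1)]→L[ℝ] ℝ) ×
      (Fin m → MultiIndex n r → (JetCoord n m r) [⋀^Fin (q - 2)]→L[ℝ] ℝ)) →ₗ[ℝ]
      (JetCoord n m r) [⋀^Fin q]→L[ℝ] ℝ where
  toFun Θ := (∑ σ : Fin m, ∑ J : MultiIndex n r,
      wedge (by omega : 1 + (q - 1) = q) (dyForm σ J.incl) (Θ.1 σ J)) +
    ∑ σ : Fin m, ∑ I : MultiIndex n r with Multiset.card I.1 + 1 = r,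
      wedge (by omega : (1 + 1) + (q - 2) = q) (extDeriv (omega σ I) 0) (Θ.2 σ I)
  map_add' Θ Θ' := by
    simp only [Prod.fst_add, Prod.snd_add, Pi.add_apply, wedge_add_right, Finset.sum_add_distrib]
    abel
  map_smul' c Θ := by
    simp only [Prod.smul_fst, Prod.smul_snd, Pi.smul_apply, wedge_smul_right, Finset.smul_sum,
      smul_add, RingHom.id_apply]

theorem contactSum_single_left {q : ℕ} (hq : 2 ≤ q) (σ : Fin m) (J : MultiIndex n r)
    (β : (JetCoord n m r) [⋀^Fin (q - 1)]→L[ℝ] ℝ) :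
    contactSum n m r hq (Pi.single σ (Pi.single J β), 0) =
      wedge (by omega : 1 + (q - 1) = q) (dyForm σ J.incl) β := by
  have hz : ∀ τ K, wedge (by omega : 1 + (q - 1) = q) (dyForm τ K)
      (0 : (JetCoord n m r) [⋀^Fin (q - 1)]→L[ℝ] ℝ) = 0 := fun τ K => by
    simpa using wedge_smul_right (by omega : 1 + (q - 1) = q) (dyForm τ K) 0 0
  have hz' : ∀ τ K, wedge (by omega : (1 + 1) + (q - 2) = q) (extDeriv (omega τ K) 0)
      (0 : (JetCoord n m r) [⋀^Fin (q - 2)]→L[ℝ] ℝ) = 0 := fun τ K => by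
    simpa using wedge_smul_right (by omega : (1 + 1) + (q - 2) = q) (extDeriv (omega τ K) 0) 0 0
  simp only [contactSum, LinearMap.coe_mk, AddHom.coe_mk, Pi.zero_apply, hz', Finset.sum_const_zero,
    add_zero]
  rw [Finset.sum_eq_single σ, Finset.sum_eq_single J]
  · simp
  · intro K _ hK
    simp [hK, hz]
  · simp
  · intro τ _ hτ
    simp [hτ, hz]
  · simp

theorem contactSum_single_right {q : ℕ} (hq : 2 ≤ q) (σ : Fin m) (I : MultiIndex n r)
    (hI : Multiset.card I.1 + 1 = r) (β : (JetCoord n m r) [⋀^Fin (q - 2)]→L[ℝ] ℝ) :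
    contactSum n m r hq (0, Pi.single σ (Pi.single I β)) =
      wedge (by omega : (1 + 1) + (q - 2) = q) (extDeriv (omega σ I) 0) β := by
  have hz : ∀ τ K, wedge (by omega : 1 + (q - 1) = q) (dyForm τ K)
      (0 : (JetCoord n m r) [⋀^Fin (q - 1)]→L[ℝ] ℝ) = 0 := fun τ K => by
    simpa using wedge_smul_right (by omega : 1 + (q - 1) = q) (dyForm τ K) 0 0
  have hz' : ∀ τ K, wedge (by omega : (1 + 1) + (q - 2) = q) (extDeriv (omega τ K) 0)
      (0 : (JetCoord n m r) [⋀^Fin (q - 2)]→L[ℝ] ℝ) = 0 := fun τ K => by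
    simpa using wedge_smul_right (by omega : (1 + 1) + (q - 2) = q) (extDeriv (omega τ K) 0) 0 0
  simp only [contactSum, LinearMap.coe_mk, AddHom.coe_mk, Pi.zero_apply, hz, Finset.sum_const_zero,
    zero_add]
  rw [Finset.sum_eq_single σ, Finset.sum_eq_single I]
  · simp
  · intro K _ hK
    simp [hK, hz']
  · intro h
    exact absurd (by simpa using hI) h
  · intro τ _ hτ
    simp [hτ, hz']
  · simp

theorem dyForm_integralElement (a : Fin m → Multiset (Fin n) → ℝ) (σ : Fin m)
    (J : MultiIndex n r) :
    (dyForm σ J.incl).compContinuousLinearMap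
      (LinearMap.toContinuousLinearMap (integralElement r a)) = 0 := by
  ext v
  change (integralElement r a (v 0)).2 σ J.incl = 0
  have : Multiset.card J.1 ≠ r := J.2.ne
  simp [integralElement_apply, MultiIndex.incl, this]

theorem extDeriv_omega_integralElement (a : Fin m → Multiset (Fin n) → ℝ) (σ : Fin m)
    (I : MultiIndex n r) (hI : Multiset.card I.1 + 1 = r) :
    (extDeriv (omega σ I) 0).compContinuousLinearMap
      (LinearMap.toContinuousLinearMap (integralElement r a)) = 0 := by
  ext v
  rw [ContinuousAlternatingMap.compContinuousLinearMap_apply, extDeriv_omega_apply]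
  simp only [Function.comp_apply, LinearMap.coe_toContinuousLinearMap', integralElement_apply,
    MultiIndex.cons, Multiset.card_cons, hI, if_true]
  change _ = (0 : ℝ)
  rw [Finset.sum_sub_distrib, sub_eq_zero]
  simp only [Finset.sum_mul]
  rw [Finset.sum_comm]
  refine Finset.sum_congr rfl fun i _ => Finset.sum_congr rfl fun j _ => ?_
  rw [Multiset.cons_swap]
  ring

theorem contactSum_integralElement {q : ℕ} (hq : 2 ≤ q) (Θ) (a : Fin m → Multiset (Fin n) → ℝ) :
    (contactSum n m r hq Θ).compContinuousLinearMap
      (LinearMap.toContinuousLinearMap (integralElement r a)) = 0 := by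
  have hadd : ∀ f g : (JetCoord n m r) [⋀^Fin q]→L[ℝ] ℝ,
      ∀ A : (Fin n → ℝ) →L[ℝ] JetCoord n m r, (f + g).compContinuousLinearMap A =
        f.compContinuousLinearMap A + g.compContinuousLinearMap A := fun _ _ _ => rfl
  have hsum : ∀ {κ : Type} (s : Finset κ) (f : κ → (JetCoord n m r) [⋀^Fin q]→L[ℝ] ℝ)
      (A : (Fin n → ℝ) →L[ℝ] JetCoord n m r), (∑ k ∈ s, f k).compContinuousLinearMap A =
        ∑ k ∈ s, (f k).compContinuousLinearMap A := fun s f A =>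
    map_sum (ContinuousAlternatingMap.compContinuousLinearMapCLM A) f s
  simp only [contactSum, LinearMap.coe_mk, AddHom.coe_mk, hadd, hsum, wedge_compContinuousLinearMap]
  rw [Finset.sum_eq_zero, Finset.sum_eq_zero, add_zero]
  · intro σ _
    refine Finset.sum_eq_zero fun I hI => ?_
    rw [extDeriv_omega_integralElement a σ I (Finset.mem_filter.1 hI).2, wedge_zero_left]
  · intro σ _
    refine Finset.sum_eq_zero fun J _ => ?_
    rw [dyForm_integralElement, wedge_zero_left]

end ContactSum

/-! ### The pointwise structure theorem -/

section Pointwise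

/-- Subtracting the orthogonal projection to the range of `f`, with respect to the inner product
pulled back along `φ`, which may be degenerate. -/
theorem exists_orthogonal_sub {V N κ : Type*} [AddCommGroup V] [Module ℝ V] [AddCommGroup N]
    [Module ℝ N] [Fintype κ] (f : V →ₗ[ℝ] N) (φ : N →ₗ[ℝ] κ → ℝ) (α : N) :
    ∃ x, ∀ x', ∑ t, φ (f x') t * φ (α - f x) t = 0 := by
  let φ' : N →ₗ[ℝ] EuclideanSpace ℝ κ := (WithLp.linearEquiv 2 ℝ (κ → ℝ)).symm.toLinearMap ∘ₗ φ
  let K : Submodule ℝ (EuclideanSpace ℝ κ) := LinearMap.range (φ' ∘ₗ f)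
  obtain ⟨x, hx⟩ : K.starProjection (φ' α) ∈ K := K.starProjection_apply_mem _
  refine ⟨x, fun x' => ?_⟩
  have h := K.sub_starProjection_mem_orthogonal (φ' α)
  rw [← hx] at h
  have h1 : inner ℝ (φ' (f x')) (φ' α - φ' (f x)) = 0 :=
    (Submodule.mem_orthogonal K _).1 h (φ' (f x')) ⟨x', rfl⟩
  rw [← map_sub] at h1
  simpa [PiLp.inner_apply, φ', mul_comm] using h1

section Orthogonal

variable {E : Type*} [NormedAddCommGroup E] [NormedSpace ℝ E] {p l k : ℕ}

/-- If `γ` is orthogonal to all products `α ∧ β`, then the contraction of `γ` with `α` vanishes. -/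
theorem contraction_eq_zero_of_orthogonal (h : p + l = k) {ι : Type*} [Fintype ι] {b : ι → E}
    (hb : Submodule.span ℝ (range b) = ⊤) (α : E [⋀^Fin p]→L[ℝ] ℝ) (γ : E [⋀^Fin k]→L[ℝ] ℝ)
    (H : ∀ β, ∑ t : Fin k → ι, wedge h α β (fun i => b (t i)) * γ (fun i => b (t i)) = 0)
    (C : (Fin p → ι) → E [⋀^Fin l]→L[ℝ] ℝ)
    (hC : ∀ t v, C t v =
      γ fun i => Sum.elim (fun j => b (t j)) v ((finSumFinEquiv.trans (finCongr h)).symm i)) :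
    ∑ t, (α fun i => b (t i)) • C t = 0 := by
  -- for this `β` the pairing of `α ∧ β` with `γ` is a multiple of the sum of the squares of the
  -- components of `β`
  set β := ∑ t, (α fun i => b (t i)) • C t with hβ
  have h1 := sum_wedge_mul h b α β γ
  rw [H, mul_zero, eq_comm, mul_eq_zero] at h1
  have h2 := h1.resolve_left (by positivity)
  have h3 : ∀ t₂ : Fin l → ι, ∑ t₁ : Fin p → ι, (α fun i => b (t₁ i)) * (β fun i => b (t₂ i)) *
      (γ fun i => b (Sum.elim t₁ t₂ ((finSumFinEquiv.trans (finCongr h)).symm i))) =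
        (β fun i => b (t₂ i)) ^ 2 := by
    intro t₂
    have h4 : (β fun i => b (t₂ i)) =
        ∑ t₁, (α fun i => b (t₁ i)) * (C t₁ fun i => b (t₂ i)) := by
      rw [hβ, ContinuousAlternatingMap.sum_apply]
      rfl
    have h7 : (β fun i => b (t₂ i)) ^ 2 =
        ∑ t₁, (α fun i => b (t₁ i)) * (C t₁ fun i => b (t₂ i)) * (β fun i => b (t₂ i)) := by
      rw [← Finset.sum_mul, ← h4, sq]
    rw [h7]
    refine Finset.sum_congr rfl fun t₁ _ => ?_
    have h5 : (fun i => b (Sum.elim t₁ t₂ ((finSumFinEquiv.trans (finCongr h)).symm i))) =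
        fun i => Sum.elim (fun j => b (t₁ j)) (fun j => b (t₂ j))
          ((finSumFinEquiv.trans (finCongr h)).symm i) := by
      funext i
      generalize (finSumFinEquiv.trans (finCongr h)).symm i = x
      rcases x with x | x <;> rfl
    rw [hC, h5]
    ring
  simp only [h3] at h2
  rw [Finset.sum_eq_zero_iff_of_nonneg fun _ _ => sq_nonneg _] at h2
  have h6 : β.toAlternatingMap = 0 :=
    eq_zero_of_apply_eq_zero hb fun t => pow_eq_zero_iff two_ne_zero |>.1 (h2 t (Finset.mem_univ t))
  exact ContinuousAlternatingMap.toAlternatingMap_injective h6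

end Orthogonal

variable {n m r : ℕ}

/-- The factorial `J! = ∏ᵢ J(i)!` of a multi-index. -/
def multiFactorial (J : Multiset (Fin n)) : ℝ := ∏ i, ((J.count i).factorial : ℝ)

theorem multiFactorial_pos (J : Multiset (Fin n)) : 0 < multiFactorial J :=
  Finset.prod_pos fun _ _ => by positivity

theorem multiFactorial_cons (i : Fin n) (J : Multiset (Fin n)) :
    multiFactorial (i ::ₘ J) = ((J.count i : ℝ) + 1) * multiFactorial J := by
  rw [multiFactorial, multiFactorial, ← Finset.mul_prod_erase _ _ (Finset.mem_univ i),
    ← Finset.mul_prod_erase Finset.univ (fun j => ((J.count j).factorial : ℝ)) (Finset.mem_univ i),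
    Multiset.count_cons_self, Nat.factorial_succ, ← mul_assoc]
  push_cast
  congr 1
  refine Finset.prod_congr rfl fun j hj => ?_
  rw [Multiset.count_cons_of_ne (Finset.ne_of_mem_erase hj)]

/-- The frame `∂/∂xⁱ`, `√(J!) ∂/∂y^σ_J`, orthonormal for an inner product for which the adjoint of
the multiplication by `∑ᵢ dy^σ_{iI} ∧ dxⁱ` is the trace operator on polynomial-valued forms. -/
def jetFrame (n m r : ℕ) : Fin n ⊕ (Fin m × MultiIndex n (r + 1)) → JetCoord n m r :=
  Sum.elim baseVector fun c => √(multiFactorial c.2.1) • fibreVector c.1 c.2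

theorem span_jetFrame : Submodule.span ℝ (range (jetFrame n m r)) = ⊤ := by
  rw [eq_top_iff]
  rintro p -
  rw [jetCoord_eq_sum p]
  have hx : LinearMap.inl ℝ (Fin n → ℝ) (Fin m → MultiIndex n (r + 1) → ℝ) p.1 =
      ∑ i, p.1 i • baseVector i := by
    refine Prod.ext ?_ ?_
    · funext k
      simp [baseVector, Prod.fst_sum, Finset.sum_apply, Pi.single_apply]
    · simp [baseVector, Prod.snd_sum]
  rw [hx]
  refine Submodule.add_mem _ (Submodule.sum_mem _ fun i _ => Submodule.smul_mem _ _ ?_)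
    (Submodule.sum_mem _ fun σ _ => Submodule.sum_mem _ fun J _ => Submodule.smul_mem _ _ ?_)
  · exact Submodule.subset_span ⟨Sum.inl i, rfl⟩
  · have h := Submodule.smul_mem (Submodule.span ℝ (range (jetFrame n m r)))
      (√(multiFactorial J.1))⁻¹ (Submodule.subset_span ⟨Sum.inr (σ, J), rfl⟩)
    have h1 : √(multiFactorial J.1) ≠ 0 := (Real.sqrt_pos.2 (multiFactorial_pos _)).ne'
    simpa [jetFrame, smul_smul, inv_mul_cancel₀ h1] using h

theorem sum_dx_jetFrame {N : Type*} [AddCommGroup N] [Module ℝ N] (B : JetCoord n m r →ₗ[ℝ] N)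
    (i : Fin n) :
    ∑ s, (jetFrame n m r s).1 i • B (jetFrame n m r s) = B (baseVector i) := by
  rw [Fintype.sum_sum_type, Finset.sum_eq_single i]
  · simp [jetFrame, baseVector, fibreVector]
  · intro j _ hj
    simp [jetFrame, baseVector, Ne.symm hj]
  · simp

theorem sum_dy_jetFrame {N : Type*} [AddCommGroup N] [Module ℝ N] (B : JetCoord n m r →ₗ[ℝ] N)
    (σ : Fin m) (J : MultiIndex n (r + 1)) :
    ∑ s, (jetFrame n m r s).2 σ J • B (jetFrame n m r s) =
      multiFactorial J.1 • B (fibreVector σ J) := by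
  have h : ∀ c : Fin m × MultiIndex n (r + 1), (jetFrame n m r (Sum.inr c)).2 σ J =
      if c = (σ, J) then √(multiFactorial J.1) else 0 := by
    rintro ⟨τ, K⟩
    change dy σ J (√(multiFactorial K.1) • fibreVector τ K) = _
    rw [map_smul, dy_fibreVector]
    by_cases h1 : σ = τ <;> by_cases h2 : J = K <;> simp_all [eq_comm]
  rw [Fintype.sum_sum_type, Finset.sum_eq_zero, zero_add]
  · simp only [h, ite_smul, zero_smul]
    rw [Finset.sum_ite_eq', if_pos (Finset.mem_univ _)]
    simp only [jetFrame, Sum.elim_inr, map_smul, smul_smul]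
    rw [Real.mul_self_sqrt (multiFactorial_pos _).le]
  · intro i _
    simp [jetFrame, baseVector]

theorem update_eq_sign_smul {E : Type*} [AddCommGroup E] [Module ℝ E] {q : ℕ}
    (γ : E [⋀^Fin (q + 1)]→ₗ[ℝ] ℝ) (v : Fin (q + 1) → E) (a : Fin (q + 1)) (x : E) :
    γ (Function.update v a x) = (-1) ^ (a : ℕ) • γ.curryLeft x (a.removeNth v) := by
  rw [← Fin.insertNth_removeNth, AlternatingMap.map_insertNth]
  rfl

/-- A form of degree `q ≤ n` vanishing on all integral elements lies in the ideal generated by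
`dy^σ_J`, `|J| < r`, and `dω^σ_I`, `|I| = r - 1`. Its component orthogonal to the ideal has no
components along `∂/∂y^σ_J`, `|J| < r`, and is trace free, hence zero. -/
theorem exists_contactSum_eq {q : ℕ} (hq : 2 ≤ q) (hqn : q ≤ n)
    {ρ : (JetCoord n m r) [⋀^Fin q]→L[ℝ] ℝ}
    (hρ : ∀ a, ρ.compContinuousLinearMap
      (LinearMap.toContinuousLinearMap (integralElement r a)) = 0) :
    ∃ Θ, contactSum n m r hq Θ = ρ := by
  let b := jetFrame n m r
  let φ : ((JetCoord n m r) [⋀^Fin q]→L[ℝ] ℝ) →ₗ[ℝ]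
      (Fin q → Fin n ⊕ (Fin m × MultiIndex n (r + 1))) → ℝ :=
    { toFun := fun γ t => γ fun i => b (t i)
      map_add' := fun _ _ => rfl
      map_smul' := fun _ _ => rfl }
  obtain ⟨Θ, hΘ⟩ := exists_orthogonal_sub (contactSum n m r hq) φ ρ
  refine ⟨Θ, ?_⟩
  set γ := ρ - contactSum n m r hq Θ with hγ
  suffices h : γ.toAlternatingMap = 0 by
    have h1 : γ = 0 := ContinuousAlternatingMap.toAlternatingMap_injective h
    exact (sub_eq_zero.1 h1).symm
  have hint : ∀ a, γ.toAlternatingMap.compLinearMap (integralElement r a) = 0 := by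
    intro a
    have h1 : γ.compContinuousLinearMap (LinearMap.toContinuousLinearMap (integralElement r a)) = 0 := by
      have h2 : γ.compContinuousLinearMap (LinearMap.toContinuousLinearMap (integralElement r a)) =
          ρ.compContinuousLinearMap (LinearMap.toContinuousLinearMap (integralElement r a)) -
          (contactSum n m r hq Θ).compContinuousLinearMap
            (LinearMap.toContinuousLinearMap (integralElement r a)) := rfl
      rw [h2, hρ, contactSum_integralElement, sub_zero]
    exact congrArg ContinuousAlternatingMap.toAlternatingMap h1
  clear_value γ
  obtain ⟨l, rfl⟩ : ∃ l, q = l + 2 := ⟨q - 2, by omega⟩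
  -- orthogonality to `dy^σ_J ∧ β`
  have hdy : ∀ (σ : Fin m) (J : MultiIndex n (r + 1)), Multiset.card J.1 < r →
      γ.curryLeft (fibreVector σ J) = 0 := by
    intro σ J hJ
    have h1 := contraction_eq_zero_of_orthogonal (by omega : 1 + (l + 1) = l + 2)
      span_jetFrame (dyForm σ J) γ
      (fun β => by
        have h2 := hΘ (Pi.single σ (Pi.single ⟨J.1, hJ⟩ β), 0)
        rw [contactSum_single_left] at h2
        exact h2)
      (fun t => γ.curryLeft (b (t 0)))
      (fun t v => by
        rw [ContinuousAlternatingMap.curryLeft_apply_apply]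
        congr 1
        funext i
        have e0 : ∀ x : Fin 1 ⊕ Fin (l + 1),
            Matrix.vecCons (b (t 0)) v ((finSumFinEquiv.trans (finCongr (by omega : 1 + (l + 1) = l + 2))) x) =
              Sum.elim (fun j => b (t j)) v x := by
          rintro (x | x)
          · rw [Subsingleton.elim x 0]; rfl
          · have : (finSumFinEquiv.trans (finCongr (by omega : 1 + (l + 1) = l + 2))) (Sum.inr x) =
                x.succ := by
              ext; simp
            rw [this]; rfl
        rw [← e0, Equiv.apply_symm_apply])
    have h3 : ∑ t : Fin 1 → _, (dyForm σ J fun i => b (t i)) • γ.curryLeft (b (t 0)) =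
        ∑ s, (b s).2 σ J • γ.curryLeft.toLinearMap (b s) :=
      Fintype.sum_equiv (Equiv.funUnique (Fin 1) _) _ _ fun t => rfl
    have h4 := h3.symm.trans h1
    rw [sum_dy_jetFrame] at h4
    exact (smul_eq_zero.1 h4).resolve_left (multiFactorial_pos _).ne'
  -- orthogonality to `dω^σ_I ∧ β`
  have htr : ∀ (σ : Fin m) (I : MultiIndex n r), Multiset.card I.1 + 1 = r →
      ∑ i, ((I.1.count i : ℝ) + 1) •
        (γ.curryLeft (baseVector i)).curryLeft (fibreVector σ (I.cons i)) = 0 := by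
    intro σ I hI
    have h1 := contraction_eq_zero_of_orthogonal (by omega : (1 + 1) + l = l + 2)
      span_jetFrame (extDeriv (omega σ I) 0) γ
      (fun β => by
        have h2 := hΘ (0, Pi.single σ (Pi.single I β))
        rw [contactSum_single_right hq σ I hI] at h2
        exact h2)
      (fun t => (γ.curryLeft (b (t 0))).curryLeft (b (t 1)))
      (fun t v => by
        rw [ContinuousAlternatingMap.curryLeft_apply_apply,
          ContinuousAlternatingMap.curryLeft_apply_apply]
        congr 1
        funext i
        have e0 : ∀ x : Fin (1 + 1) ⊕ Fin l,
            Matrix.vecCons (b (t 0)) (Matrix.vecCons (b (t 1)) v)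
              ((finSumFinEquiv.trans (finCongr (by omega : (1 + 1) + l = l + 2))) x) =
              Sum.elim (fun j => b (t j)) v x := by
          rintro (x | x)
          · fin_cases x <;> rfl
          · have : (finSumFinEquiv.trans (finCongr (by omega : (1 + 1) + l = l + 2))) (Sum.inr x) =
                x.succ.succ := by
              ext; simp
            rw [this]; rfl
        rw [← e0, Equiv.apply_symm_apply])
    let B : JetCoord n m r →ₗ[ℝ] JetCoord n m r →ₗ[ℝ] (JetCoord n m r) [⋀^Fin l]→L[ℝ] ℝ :=
      LinearMap.mk₂ ℝ (fun x y => (γ.curryLeft x).curryLeft y)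
        (fun x x' y => by simp) (fun c x y => by simp) (fun x y y' => by simp)
        (fun c x y => by simp)
    have hB : ∀ x y, B x y = -B y x := by
      intro x y
      have h5 : B (x + y) (x + y) = 0 := ContinuousAlternatingMap.curryLeft_same γ (x + y)
      have h6 : B x x = 0 := ContinuousAlternatingMap.curryLeft_same γ x
      have h7 : B y y = 0 := ContinuousAlternatingMap.curryLeft_same γ y
      simp only [map_add, LinearMap.add_apply, h6, h7, zero_add, add_zero] at h5
      exact eq_neg_of_add_eq_zero_right h5
    have h3 : ∑ t : Fin (1 + 1) → _, (extDeriv (omega σ I) 0 fun i => b (t i)) •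
          (γ.curryLeft (b (t 0))).curryLeft (b (t 1)) =
        ∑ s, ∑ s', (∑ i, ((b s').2 σ (I.cons i) * (b s).1 i - (b s).2 σ (I.cons i) * (b s').1 i)) •
          B (b s) (b s') := by
      rw [← Fintype.sum_prod_type' (f := fun s s' => (∑ i, ((b s').2 σ (I.cons i) * (b s).1 i -
        (b s).2 σ (I.cons i) * (b s').1 i)) • B (b s) (b s'))]
      refine Fintype.sum_equiv (finTwoArrowEquiv _) _ _ fun t => ?_
      rw [extDeriv_omega_apply]
      rfl
    -- the two halves of the antisymmetric form `dω^σ_I` contribute equally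
    have h4 : ∑ s, ∑ s', (∑ i, ((b s').2 σ (I.cons i) * (b s).1 i -
          (b s).2 σ (I.cons i) * (b s').1 i)) • B (b s) (b s') =
        ∑ i, (2 * multiFactorial (i ::ₘ I.1)) • B (baseVector i) (fibreVector σ (I.cons i)) := by
      have h5 : ∀ i, ∑ s, ∑ s', ((b s').2 σ (I.cons i) * (b s).1 i) • B (b s) (b s') =
          multiFactorial (i ::ₘ I.1) • B (baseVector i) (fibreVector σ (I.cons i)) := by
        intro i
        have h6 : ∀ s, ∑ s', ((b s').2 σ (I.cons i) * (b s).1 i) • B (b s) (b s') =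
            (b s).1 i • multiFactorial (i ::ₘ I.1) • B.flip (fibreVector σ (I.cons i)) (b s) := by
          intro s
          have h7 := sum_dy_jetFrame (B (b s)) σ (I.cons i)
          rw [LinearMap.flip_apply]
          refine Eq.trans ?_ (congrArg ((b s).1 i • ·) h7)
          simp only [Finset.smul_sum, smul_smul, mul_comm]
          rfl
        simp only [h6, smul_comm _ (multiFactorial _), ← Finset.smul_sum]
        rw [sum_dx_jetFrame, LinearMap.flip_apply]
      have h8 : ∀ i, ∑ s, ∑ s', ((b s).2 σ (I.cons i) * (b s').1 i) • B (b s) (b s') =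
          -(multiFactorial (i ::ₘ I.1) • B (baseVector i) (fibreVector σ (I.cons i))) := by
        intro i
        rw [← h5, Finset.sum_comm, ← Finset.sum_neg_distrib]
        refine Finset.sum_congr rfl fun s _ => ?_
        rw [← Finset.sum_neg_distrib]
        refine Finset.sum_congr rfl fun s' _ => ?_
        rw [hB, smul_neg]
      have hswap : ∀ f : Fin n ⊕ Fin m × MultiIndex n (r + 1) → Fin n ⊕ Fin m × MultiIndex n (r + 1) →
            Fin n → (JetCoord n m r) [⋀^Fin l]→L[ℝ] ℝ,
          ∑ s, ∑ s', ∑ i, f s s' i = ∑ i, ∑ s, ∑ s', f s s' i := fun f => by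
        rw [Finset.sum_congr rfl fun s _ => Finset.sum_comm, Finset.sum_comm]
      simp only [Finset.sum_smul]
      rw [hswap]
      refine Finset.sum_congr rfl fun i _ => ?_
      simp only [sub_smul, Finset.sum_sub_distrib]
      rw [h5, h8, sub_neg_eq_add, two_mul, add_smul]
    have h9 := (h3.trans h4).symm.trans h1
    simp only [multiFactorial_cons] at h9
    have h10 : (2 * multiFactorial I.1) • ∑ i, ((I.1.count i : ℝ) + 1) •
        B (baseVector i) (fibreVector σ (I.cons i)) = 0 := by
      rw [← h9, Finset.smul_sum]
      exact Finset.sum_congr rfl fun i _ => by rw [smul_smul]; congr 1; ring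
    exact (smul_eq_zero.1 h10).resolve_left (mul_pos two_pos (multiFactorial_pos _)).ne'
  -- pass from the first arguments of `γ` to arbitrary positions
  refine eq_zero_of_isTraceFree hqn ?_ ?_ hint
  · intro v a σ J hJ
    rw [update_eq_sign_smul]
    have h1 := congrArg (fun G => G (a.removeNth v)) (hdy σ J hJ)
    have h2 : γ.toAlternatingMap.curryLeft (fibreVector σ J) (a.removeNth v) = 0 := h1
    rw [h2, smul_zero]
  · intro σ I hI v a c hac
    obtain ⟨c', rfl⟩ := Fin.exists_succAbove_eq hac.symm
    have h1 : ∀ x y, γ.toAlternatingMap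
        (Function.update (Function.update v a x) (a.succAbove c') y) =
        ((-1) ^ (a : ℕ) * (-1) ^ (c' : ℕ)) * (γ.curryLeft x).curryLeft y
          (c'.removeNth (a.removeNth v)) := by
      intro x y
      rw [Function.update_comm hac, update_eq_sign_smul, Fin.removeNth_update_succAbove,
        update_eq_sign_smul]
      simp only [zsmul_eq_mul, Int.cast_pow, Int.cast_neg, Int.cast_one, mul_assoc]
      rfl
    simp only [h1, smul_eq_mul, mul_left_comm _ ((-1) ^ (a : ℕ) * (-1) ^ (c' : ℕ) : ℝ),
      ← Finset.mul_sum]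
    have h2 := congrArg (fun G => G (c'.removeNth (a.removeNth v))) (htr σ I hI)
    simp only [ContinuousAlternatingMap.sum_apply] at h2
    refine mul_eq_zero_of_right _ ?_
    exact h2

end Pointwise

/-! ### Iterated partial derivatives -/

section PartialDeriv

variable {n : ℕ} {s : Set (Fin n → ℝ)} {g : (Fin n → ℝ) → ℝ}

/-- The partial derivatives of `g` along the coordinate directions of a list, taken one after the
other; the head of the list is the outermost derivative. -/
def listDeriv : List (Fin n) → ((Fin n → ℝ) → ℝ) → (Fin n → ℝ) → ℝ
  | [], g => g
  | i :: l, g => fun z => fderiv ℝ (listDeriv l g) z (Pi.single i 1)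

theorem listDeriv_cons (i : Fin n) (l : List (Fin n)) (g : (Fin n → ℝ) → ℝ) (z : Fin n → ℝ) :
    listDeriv (i :: l) g z = fderiv ℝ (listDeriv l g) z (Pi.single i 1) :=
  rfl

theorem contDiffOn_listDeriv (hs : IsOpen s) (hg : ContDiffOn ℝ ∞ g s) :
    ∀ l : List (Fin n), ContDiffOn ℝ ∞ (listDeriv l g) s
  | [] => hg
  | _ :: l => ((contDiffOn_listDeriv hs hg l).fderiv_of_isOpen hs (by simp)).clm_apply
      contDiffOn_const

/-- Smooth functions have symmetric higher derivatives. -/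
theorem listDeriv_perm (hs : IsOpen s) (hg : ContDiffOn ℝ ∞ g s) {l l' : List (Fin n)}
    (h : l.Perm l') : EqOn (listDeriv l g) (listDeriv l' g) s := by
  induction h with
  | nil => exact fun _ _ => rfl
  | cons i _ ih =>
    intro z hz
    have h1 := ih.eventuallyEq_of_mem (hs.mem_nhds hz)
    simp only [listDeriv, h1.fderiv_eq]
  | swap i j l =>
    intro z hz
    have h1 := (contDiffOn_listDeriv hs hg l).contDiffAt (hs.mem_nhds hz)
    have h2 : DifferentiableAt ℝ (fderiv ℝ (listDeriv l g)) z :=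
      (h1.fderiv_right (m := ∞) (by simp)).differentiableAt (by simp)
    have h3 := h1.isSymmSndFDerivAt
      (by simpa using (WithTop.coe_le_coe.2 le_top : ((2 : ℕ∞) : WithTop ℕ∞) ≤ ∞)) (Pi.single i (1 : ℝ)) (Pi.single j (1 : ℝ))
    have h4 : ∀ u v, fderiv ℝ (fun w => fderiv ℝ (listDeriv l g) w u) z v =
        fderiv ℝ (fderiv ℝ (listDeriv l g)) z v u := by
      intro u v
      rw [fderiv_clm_apply h2 (differentiableAt_const u)]
      simp
    simp only [listDeriv]
    rw [h4, h4, h3]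
  | trans _ _ ih ih' => exact ih.trans ih'

theorem iteratedFDeriv_apply_eq_listDeriv (hs : IsOpen s) (hg : ContDiffOn ℝ ∞ g s)
    (l : List (Fin n)) : ∀ z ∈ s,
      iteratedFDeriv ℝ l.length g z (fun k => Pi.single (l.get k) (1 : ℝ)) = listDeriv l g z := by
  induction l with
  | nil => exact fun z _ => iteratedFDeriv_zero_apply _
  | cons i l ih =>
    intro z hz
    have h1 : DifferentiableAt ℝ (iteratedFDeriv ℝ l.length g) z :=
      ((hg.contDiffAt (hs.mem_nhds hz)).iteratedFDeriv_right (m := 1) (i := l.length)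
        (by exact_mod_cast le_top)).differentiableAt (by simp)
    have h2 : (fun w => iteratedFDeriv ℝ l.length g w
        (fun k => Pi.single (l.get k) (1 : ℝ))) =ᶠ[𝓝 z] listDeriv l g :=
      Filter.eventually_of_mem (hs.mem_nhds hz) ih
    change iteratedFDeriv ℝ (l.length + 1) g z _ = _
    rw [iteratedFDeriv_succ_apply_left, listDeriv_cons, ← h2.fderiv_eq]
    have h3 := (h1.hasFDerivAt.continuousMultilinear_apply_const
      (fun k => Pi.single (l.get k) (1 : ℝ))).fderiv
    rw [h3]
    rfl

theorem partialDeriv_coe (hs : IsOpen s) (hg : ContDiffOn ℝ ∞ g s) (l : List (Fin n)) :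
    EqOn (partialDeriv (l : Multiset (Fin n)) g) (listDeriv l g) s := by
  intro z hz
  rw [partialDeriv, iteratedFDeriv_apply_eq_listDeriv hs hg _ z hz]
  exact listDeriv_perm hs hg (Multiset.coe_eq_coe.1 (Multiset.sort_eq _ _)) hz

theorem partialDeriv_zero (g : (Fin n → ℝ) → ℝ) (z : Fin n → ℝ) : partialDeriv 0 g z = g z := by
  have h : ∀ l : List (Fin n), l = [] →
      iteratedFDeriv ℝ l.length g z (fun k => Pi.single (l.get k) (1 : ℝ)) = g z := by
    rintro _ rfl
    exact iteratedFDeriv_zero_apply _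
  exact h _ (Multiset.sort_zero _)

theorem contDiffOn_partialDeriv (hs : IsOpen s) (hg : ContDiffOn ℝ ∞ g s) (J : Multiset (Fin n)) :
    ContDiffOn ℝ ∞ (partialDeriv J g) s := by
  induction J using Quotient.inductionOn with
  | h l => exact (contDiffOn_listDeriv hs hg l).congr (partialDeriv_coe hs hg l)

theorem fderiv_partialDeriv (hs : IsOpen s) (hg : ContDiffOn ℝ ∞ g s) (J : Multiset (Fin n))
    (i : Fin n) {z : Fin n → ℝ} (hz : z ∈ s) :
    fderiv ℝ (partialDeriv J g) z (Pi.single i 1) = partialDeriv (i ::ₘ J) g z := by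
  induction J using Quotient.inductionOn with
  | h l =>
    have h1 := (partialDeriv_coe hs hg l).eventuallyEq_of_mem (hs.mem_nhds hz)
    have h2 := partialDeriv_coe hs hg (i :: l) hz
    rw [← Multiset.cons_coe] at h2
    exact (congrArg (fun G : (Fin n → ℝ) →L[ℝ] ℝ => G (Pi.single i 1)) h1.fderiv_eq).trans h2.symm

theorem partialDeriv_congr {g g' : (Fin n → ℝ) → ℝ} {z : Fin n → ℝ} (h : g =ᶠ[𝓝 z] g')
    (J : Multiset (Fin n)) : partialDeriv J g z = partialDeriv J g' z := by
  rw [partialDeriv, partialDeriv, (h.iteratedFDeriv ℝ _).eq_of_nhds]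

/-! ### Functions with prescribed partial derivatives at a point -/

/-- The divided power `(w - z)^K / K!`. -/
def dividedPower (z : Fin n → ℝ) (K : Multiset (Fin n)) (w : Fin n → ℝ) : ℝ :=
  ∏ j, (w j - z j) ^ K.count j / (K.count j).factorial

theorem contDiff_dividedPower (z : Fin n → ℝ) (K : Multiset (Fin n)) :
    ContDiff ℝ ∞ (dividedPower z K) := by
  unfold dividedPower
  fun_prop

theorem dividedPower_self (z : Fin n → ℝ) (K : Multiset (Fin n)) :
    dividedPower z K z = if K = 0 then 1 else 0 := by
  split_ifs with h
  · simp [dividedPower, h]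
  · obtain ⟨j, hj⟩ := Multiset.exists_mem_of_ne_zero h
    refine Finset.prod_eq_zero (Finset.mem_univ j) ?_
    simp [Multiset.count_ne_zero.2 hj]

theorem fderiv_dividedPower (z w : Fin n → ℝ) (K : Multiset (Fin n)) (i : Fin n) :
    fderiv ℝ (dividedPower z K) w (Pi.single i 1) =
      if i ∈ K then dividedPower z (K.erase i) w else 0 := by
  have h1 : ∀ j ∈ (Finset.univ : Finset (Fin n)),
      HasFDerivAt (fun w : Fin n → ℝ => (w j - z j) ^ K.count j / (K.count j).factorial)
        ((K.count j * (w j - z j) ^ (K.count j - 1) / (K.count j).factorial : ℝ) •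
          ContinuousLinearMap.proj (R := ℝ) (φ := fun _ : Fin n => ℝ) j) w := by
    intro j _
    have h2 : HasDerivAt (fun t : ℝ => (t - z j) ^ K.count j / (K.count j).factorial)
        (K.count j * (w j - z j) ^ (K.count j - 1) / (K.count j).factorial : ℝ) (w j) := by
      have := (((hasDerivAt_id (w j)).sub_const (z j)).pow (K.count j)).div_const
        ((K.count j).factorial : ℝ)
      simpa using this
    exact h2.comp_hasFDerivAt w
      (ContinuousLinearMap.proj (R := ℝ) (φ := fun _ : Fin n => ℝ) j).hasFDerivAt
  have h3 := (HasFDerivAt.finsetProd h1).fderiv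
  change fderiv ℝ (fun w => _) w _ = _
  unfold dividedPower
  rw [h3, sum_apply, Finset.sum_eq_single i]
  · simp only [smul_apply, ContinuousLinearMap.proj_apply, Pi.single_eq_same, smul_eq_mul, mul_one]
    split_ifs with h
    · obtain ⟨L, rfl⟩ := Multiset.exists_cons_of_mem h
      rw [Multiset.erase_cons_head, ← Finset.prod_erase_mul _ _ (Finset.mem_univ i)]
      congr 1
      · refine Finset.prod_congr rfl fun j hj => ?_
        rw [Multiset.count_cons_of_ne (Finset.ne_of_mem_erase hj)]
      · rw [Multiset.count_cons_self, Nat.factorial_succ, Nat.add_sub_cancel]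
        push_cast
        have : ((L.count i : ℝ) + 1) ≠ 0 := by positivity
        field_simp
    · simp [Multiset.count_eq_zero.2 h]
  · intro j _ hj
    simp [hj]
  · simp

theorem listDeriv_dividedPower (z : Fin n → ℝ) (K : Multiset (Fin n)) (l : List (Fin n)) :
    listDeriv l (dividedPower z K) =
      if (l : Multiset (Fin n)) ≤ K then dividedPower z (K - l) else 0 := by
  induction l with
  | nil => simp [listDeriv]
  | cons i l ih =>
    funext w
    rw [listDeriv_cons, ih, ← Multiset.cons_coe]
    by_cases h : (l : Multiset (Fin n)) ≤ K
    · obtain ⟨L, rfl⟩ := Multiset.le_iff_exists_add.1 h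
      rw [if_pos h, add_tsub_cancel_left, fderiv_dividedPower]
      have h1 : (i ::ₘ (l : Multiset (Fin n)) ≤ l + L) ↔ i ∈ L := by
        rw [← Multiset.singleton_add, add_comm, add_le_add_iff_left, Multiset.singleton_le]
      simp only [h1]
      split_ifs with h2
      · rw [← Multiset.singleton_add, add_comm, add_tsub_add_eq_tsub_right, Multiset.sub_singleton]
      · rfl
    · have h1 : ¬ i ::ₘ (l : Multiset (Fin n)) ≤ K := fun h' =>
        h ((Multiset.le_cons_self _ _).trans h')
      rw [if_neg h, if_neg h1]
      simp

theorem listDeriv_sum {ι : Type*} (t : Finset ι) (c : ι → ℝ) (f : ι → (Fin n → ℝ) → ℝ)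
    (hf : ∀ k, ContDiff ℝ ∞ (f k)) (l : List (Fin n)) :
    listDeriv l (fun w => ∑ k ∈ t, c k * f k w) = fun w => ∑ k ∈ t, c k * listDeriv l (f k) w := by
  induction l with
  | nil => rfl
  | cons i l ih =>
    funext w
    have h1 : ∀ k ∈ t, HasFDerivAt (fun w => c k * listDeriv l (f k) w)
        (c k • fderiv ℝ (listDeriv l (f k)) w) w := fun k _ =>
      (((contDiffOn_univ.1 (contDiffOn_listDeriv isOpen_univ (hf k).contDiffOn l)).differentiable
        (by simp) w).hasFDerivAt).const_mul (c k)
    rw [listDeriv_cons, ih, (HasFDerivAt.fun_sum h1).fderiv, sum_apply]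
    rfl

/-- Taylor polynomials have prescribed derivatives. -/
theorem exists_partialDeriv_eq (z : Fin n → ℝ) (N : ℕ) (a : Multiset (Fin n) → ℝ) :
    ∃ g : (Fin n → ℝ) → ℝ, ContDiff ℝ ∞ g ∧
      ∀ K, Multiset.card K < N → partialDeriv K g z = a K := by
  have hsm : ContDiff ℝ ∞ fun w => ∑ L : MultiIndex n N, a L.1 * dividedPower z L.1 w :=
    ContDiff.sum fun L _ => contDiff_const.mul (contDiff_dividedPower z L.1)
  refine ⟨_, hsm, fun K hK => ?_⟩
  obtain ⟨l, rfl⟩ : ∃ l : List (Fin n), (l : Multiset (Fin n)) = K := Quot.exists_rep K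
  rw [partialDeriv_coe isOpen_univ hsm.contDiffOn l (mem_univ z),
    listDeriv_sum _ (fun L : MultiIndex n N => a L.1) _ (fun L => contDiff_dividedPower z L.1)]
  simp only
  rw [Finset.sum_eq_single ⟨l, hK⟩]
  · rw [listDeriv_dividedPower, if_pos le_rfl, tsub_self, dividedPower_self, if_pos rfl, mul_one]
  · intro L _ hL
    rw [listDeriv_dividedPower]
    split_ifs with h
    · rw [dividedPower_self, if_neg, mul_zero]
      exact fun h' => hL (Subtype.ext (le_antisymm (tsub_eq_zero_iff_le.1 h') h))
    · exact mul_zero _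
  · simp

end PartialDeriv

/-! ### Tangent spaces of prolonged sections -/

section Geometry

variable {n m r : ℕ}

/-- The adapted isomorphism at `p`, which takes `dy^σ_J` to `ω^σ_J` for `|J| < r`: the vector
`(ξ, η)` is sent to the vector with components `ξⁱ` and `η^σ_J + ∑ᵢ y^σ_{iJ} ξⁱ`, where the sum is
absent if `|J| = r`. -/
def totalLift (p : JetCoord n m r) : JetCoord n m r →ₗ[ℝ] JetCoord n m r where
  toFun u := (u.1, fun σ J => u.2 σ J +
    if h : Multiset.card J.1 < r then ∑ i, u.1 i * p.2 σ (MultiIndex.cons i ⟨J.1, h⟩) else 0)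
  map_add' u v := by
    refine Prod.ext rfl (funext fun σ => funext fun J => ?_)
    by_cases h : Multiset.card J.1 < r
    · simp [h, add_mul, Finset.sum_add_distrib]
      ring
    · simp [h]
  map_smul' c u := by
    refine Prod.ext rfl (funext fun σ => funext fun J => ?_)
    by_cases h : Multiset.card J.1 < r
    · simp [h, Finset.mul_sum, mul_add, mul_assoc]
    · simp [h]

variable {X : Type*} [TopologicalSpace X] [ChartedSpace (Fin n → ℝ) X]
  {Y : Type*} [TopologicalSpace Y] [ChartedSpace ((Fin n → ℝ) × (Fin m → ℝ)) Y]
  {π : Y → X}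

/-- The component `y^σ ∘ γ ∘ φ⁻¹` of the coordinate expression of the section `γ`. -/
def AdaptedChart.component (c : AdaptedChart n m π) (γ : LocalSection n m π) (σ : Fin m)
    (w : Fin n → ℝ) : ℝ :=
  (c.total (γ.toFun (c.base.symm w))).2 σ

/-- The points of the coordinate domain at which the section is defined with values in the domain
of the adapted chart. -/
def AdaptedChart.sectionDomain (c : AdaptedChart n m π) (γ : LocalSection n m π) :
    Set (Fin n → ℝ) :=
  c.base.target ∩ c.base.symm ⁻¹' (γ.domain ∩ γ.toFun ⁻¹' c.total.source)

theorem AdaptedChart.isOpen_sectionDomain (c : AdaptedChart n m π) (γ : LocalSection n m π) :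
    IsOpen (c.sectionDomain γ) :=
  c.base.symm.isOpen_inter_preimage
    (γ.smooth.continuousOn.isOpen_inter_preimage γ.isOpen_domain c.total.open_source)

theorem AdaptedChart.contDiffOn_component [IsManifold 𝓘(ℝ, Fin n → ℝ) ∞ X]
    [IsManifold 𝓘(ℝ, (Fin n → ℝ) × (Fin m → ℝ)) ∞ Y] (c : AdaptedChart n m π)
    (γ : LocalSection n m π) (σ : Fin m) :
    ContDiffOn ℝ ∞ (c.component γ σ) (c.sectionDomain γ) := by
  have h1 : ContMDiffOn 𝓘(ℝ, Fin n → ℝ) 𝓘(ℝ, (Fin n → ℝ) × (Fin m → ℝ)) ∞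
      (fun w => c.total (γ.toFun (c.base.symm w))) (c.sectionDomain γ) :=
    (contMDiffOn_of_mem_maximalAtlas c.total_mem).comp
      (γ.smooth.comp ((contMDiffOn_symm_of_mem_maximalAtlas c.base_mem).mono inter_subset_left)
        fun w hw => hw.2.1) fun w hw => hw.2.2
  have h2 := contMDiffOn_iff_contDiffOn.1 h1
  exact contDiffOn_pi.1 (contDiff_snd.comp_contDiffOn h2) σ

theorem AdaptedChart.mem_base_source (c : AdaptedChart n m π) {y : Y} (hy : y ∈ c.total.source) :
    π y ∈ c.base.source :=
  c.base_source ▸ mem_image_of_mem π hy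

theorem AdaptedChart.mem_sectionDomain (c : AdaptedChart n m π) (γ : LocalSection n m π) {x : X}
    (hx : x ∈ γ.domain) (hc : γ.toFun x ∈ c.total.source) : c.base x ∈ c.sectionDomain γ := by
  have h := c.mem_base_source hc
  rw [γ.section_eq x hx] at h
  refine ⟨c.base.map_source h, ?_⟩
  rw [mem_preimage, c.base.left_inv h]
  exact ⟨hx, hc⟩

theorem AdaptedChart.prolong_mem_jetTarget (c : AdaptedChart n m π) (γ : LocalSection n m π) {x : X}
    (hx : x ∈ γ.domain) (hc : γ.toFun x ∈ c.total.source) :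
    c.prolong r γ (c.base x) ∈ c.jetTarget r := by
  have h := c.mem_base_source hc
  rw [γ.section_eq x hx] at h
  have h1 : ((c.prolong r γ (c.base x)).1, fun σ => (c.prolong r γ (c.base x)).2 σ MultiIndex.nil) =
      c.total (γ.toFun x) := by
    refine Prod.ext ?_ (funext fun σ => ?_)
    · rw [c.proj_eq _ hc, γ.section_eq x hx]
      rfl
    · refine (partialDeriv_zero _ _).trans ?_
      simp only [c.base.left_inv h]
  change (_, _) ∈ c.total.target
  rw [h1]
  exact c.total.map_source hc

/-- The tangent space of a prolonged section at a point of the jet bundle is the image of an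
integral element under the adapted isomorphism; the integral element is given by the derivatives
of order `r + 1`. -/
theorem AdaptedChart.fderiv_prolong [IsManifold 𝓘(ℝ, Fin n → ℝ) ∞ X]
    [IsManifold 𝓘(ℝ, (Fin n → ℝ) × (Fin m → ℝ)) ∞ Y] (c : AdaptedChart n m π)
    (γ : LocalSection n m π) {z : Fin n → ℝ} (hz : z ∈ c.sectionDomain γ) :
    fderiv ℝ (c.prolong r γ) z =
      (totalLift (c.prolong r γ z)).toContinuousLinearMap.comp
        (integralElement r fun σ K => partialDeriv K (c.component γ σ) z).toContinuousLinearMap := by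
  have ho := c.isOpen_sectionDomain γ
  have h1 : HasFDerivAt (c.prolong r γ) ((ContinuousLinearMap.id ℝ (Fin n → ℝ)).prod
      (ContinuousLinearMap.pi fun σ => ContinuousLinearMap.pi fun J : MultiIndex n (r + 1) =>
        fderiv ℝ (partialDeriv J.1 (c.component γ σ)) z)) z := by
    refine (hasFDerivAt_id z).prodMk (hasFDerivAt_pi.2 fun σ => hasFDerivAt_pi.2 fun J => ?_)
    exact (((contDiffOn_partialDeriv ho (c.contDiffOn_component γ σ) J.1).contDiffAt
      (ho.mem_nhds hz)).differentiableAt (by simp)).hasFDerivAt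
  rw [h1.fderiv]
  refine ContinuousLinearMap.ext fun v => Prod.ext rfl (funext fun σ => funext fun J => ?_)
  change fderiv ℝ (partialDeriv J.1 (c.component γ σ)) z v = _
  have h2 : v = ∑ i, v i • Pi.single i (1 : ℝ) := by
    simpa using (pi_eq_sum_univ' v)
  have h3 : fderiv ℝ (partialDeriv J.1 (c.component γ σ)) z v =
      ∑ i, v i * partialDeriv (i ::ₘ J.1) (c.component γ σ) z := by
    conv_lhs => rw [h2]
    rw [map_sum]
    refine Finset.sum_congr rfl fun i _ => ?_
    rw [map_smul, fderiv_partialDeriv ho (c.contDiffOn_component γ σ) J.1 i hz, smul_eq_mul]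
  rw [h3]
  have hJ := Nat.lt_succ_iff.1 J.2
  rcases hJ.lt_or_eq with h | h
  · simp [totalLift, integralElement_apply, h, h.ne, AdaptedChart.prolong, MultiIndex.cons]
    rfl
  · simp [totalLift, integralElement_apply, h, mul_comm (v _)]

theorem AdaptedChart.base_symm_eq (c : AdaptedChart n m π) {u : (Fin n → ℝ) × (Fin m → ℝ)}
    (hu : u ∈ c.total.target) : π (c.total.symm u) ∈ c.base.source ∧
      c.base (π (c.total.symm u)) = u.1 := by
  have h := c.total.map_target hu
  refine ⟨c.mem_base_source h, ?_⟩
  rw [← c.proj_eq _ h, c.total.right_inv hu]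

/-- Every `r`-jet with prescribed derivatives of order `r + 1` is realized by a section. -/
theorem AdaptedChart.exists_section [IsManifold 𝓘(ℝ, Fin n → ℝ) ∞ X]
    [IsManifold 𝓘(ℝ, (Fin n → ℝ) × (Fin m → ℝ)) ∞ Y] (c : AdaptedChart n m π)
    {p : JetCoord n m r} (hp : p ∈ c.jetTarget r) (a : Fin m → Multiset (Fin n) → ℝ) :
    ∃ (γ : LocalSection n m π) (x : X), x ∈ γ.domain ∧ γ.toFun x ∈ c.total.source ∧
      c.base x = p.1 ∧ c.prolong r γ p.1 = p ∧
      ∀ σ K, Multiset.card K = r + 1 → partialDeriv K (c.component γ σ) p.1 = a σ K := by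
  choose g hg hgK using fun σ : Fin m => exists_partialDeriv_eq p.1 (r + 2)
    (fun K => if h : Multiset.card K < r + 1 then p.2 σ ⟨K, h⟩ else a σ K)
  let G : (Fin n → ℝ) → (Fin n → ℝ) × (Fin m → ℝ) := fun w => (w, fun σ => g σ w)
  have hG : ContDiff ℝ ∞ G := contDiff_id.prodMk (contDiff_pi.2 hg)
  have hGp : G p.1 ∈ c.total.target := by
    have h : G p.1 = (p.1, fun σ => p.2 σ MultiIndex.nil) := by
      refine Prod.ext rfl (funext fun σ => ?_)
      change g σ p.1 = _
      rw [← partialDeriv_zero (g σ) p.1, hgK σ 0 (by simp), dif_pos (by simp)]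
      rfl
    rw [h]
    exact hp
  let γ : LocalSection n m π :=
    { domain := c.base.source ∩ c.base ⁻¹' (G ⁻¹' c.total.target)
      isOpen_domain := c.base.isOpen_inter_preimage (c.total.open_target.preimage hG.continuous)
      toFun := fun x => c.total.symm (G (c.base x))
      smooth := by
        refine (contMDiffOn_symm_of_mem_maximalAtlas c.total_mem).comp
          (hG.contMDiff.comp_contMDiffOn
            ((contMDiffOn_of_mem_maximalAtlas c.base_mem).mono inter_subset_left)) fun x hx => hx.2
      section_eq := fun x hx =>
        c.base.injOn (c.base_symm_eq hx.2).1 hx.1 (c.base_symm_eq hx.2).2 }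
  have hpt : p.1 ∈ c.base.target := by
    have h := c.base_symm_eq hGp
    exact h.2 ▸ c.base.map_source h.1
  have hbase : c.base (c.base.symm p.1) = p.1 := c.base.right_inv hpt
  have hcomp : ∀ σ, c.component γ σ =ᶠ[𝓝 p.1] g σ := by
    intro σ
    filter_upwards [c.base.open_target.mem_nhds hpt,
      (c.total.open_target.preimage hG.continuous).mem_nhds hGp] with w hw hw'
    change (c.total (c.total.symm (G (c.base (c.base.symm w))))).2 σ = _
    rw [c.base.right_inv hw, c.total.right_inv hw']
  refine ⟨γ, c.base.symm p.1, ⟨c.base.map_target hpt, ?_⟩, ?_, hbase, ?_, ?_⟩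
  · rw [mem_preimage, hbase]
    exact hGp
  · change c.total.symm (G (c.base (c.base.symm p.1))) ∈ _
    rw [hbase]
    exact c.total.map_target hGp
  · refine Prod.ext rfl (funext fun σ => funext fun J => ?_)
    refine (partialDeriv_congr (hcomp σ) J.1).trans ?_
    rw [hgK σ J.1 (J.2.trans (Nat.lt_succ_self _)), dif_pos J.2]
  · intro σ K hK
    rw [partialDeriv_congr (hcomp σ), hgK σ K (by omega), dif_neg (by omega)]

end Geometry

/-! ### The basic contact forms under the adapted isomorphism -/

section Adapted

variable {n m r : ℕ}

/-- The lift changes the components `η^σ_J` by terms involving `ξ` only, so that reversing the sign of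
`p` gives the inverse. -/
theorem totalLift_comp_neg (p : JetCoord n m r) :
    (totalLift p).toContinuousLinearMap.comp (totalLift (-p)).toContinuousLinearMap =
      ContinuousLinearMap.id ℝ _ := by
  refine ContinuousLinearMap.ext fun u => Prod.ext rfl (funext fun σ => funext fun J => ?_)
  by_cases h : Multiset.card J.1 < r
  · simp [totalLift, h]
  · simp [totalLift, h]

theorem totalLift_neg_comp (p : JetCoord n m r) :
    (totalLift (-p)).toContinuousLinearMap.comp (totalLift p).toContinuousLinearMap =
      ContinuousLinearMap.id ℝ _ := by
  simpa using totalLift_comp_neg (-p)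

theorem dyForm_totalLift_neg (p : JetCoord n m r) (σ : Fin m) (J : MultiIndex n r) :
    (dyForm σ J.incl).compContinuousLinearMap (totalLift (-p)).toContinuousLinearMap =
      omega σ J p := by
  ext v
  rw [omega_apply]
  change (totalLift (-p) (v 0)).2 σ J.incl = _
  simp [totalLift, MultiIndex.incl, J.2, sub_eq_add_neg, mul_comm]

/-- The lift does not change the components with `|J| = r`, the only ones occurring in `dω^σ_I`. -/
theorem extDeriv_omega_totalLift_neg (p : JetCoord n m r) (σ : Fin m) (I : MultiIndex n r)
    (hI : Multiset.card I.1 + 1 = r) :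
    (extDeriv (omega σ I) 0).compContinuousLinearMap (totalLift (-p)).toContinuousLinearMap =
      extDeriv (omega σ I) p := by
  ext v
  rw [ContinuousAlternatingMap.compContinuousLinearMap_apply, extDeriv_omega_apply,
    extDeriv_omega_apply]
  simp [totalLift, MultiIndex.cons, hI]

theorem contactSum_totalLift_neg {q : ℕ} (hq : 2 ≤ q) (p : JetCoord n m r) (Θ) :
    (contactSum n m r hq Θ).compContinuousLinearMap (totalLift (-p)).toContinuousLinearMap =
      (∑ σ : Fin m, ∑ J : MultiIndex n r, wedge (by omega : 1 + (q - 1) = q) (omega σ J p)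
          ((Θ.1 σ J).compContinuousLinearMap (totalLift (-p)).toContinuousLinearMap)) +
        ∑ σ : Fin m, ∑ I : MultiIndex n r with Multiset.card I.1 + 1 = r,
          wedge (by omega : (1 + 1) + (q - 2) = q) (extDeriv (omega σ I) p)
            ((Θ.2 σ I).compContinuousLinearMap (totalLift (-p)).toContinuousLinearMap) := by
  have hsum : ∀ {κ : Type} (s : Finset κ) (f : κ → (JetCoord n m r) [⋀^Fin q]→L[ℝ] ℝ)
      (A : JetCoord n m r →L[ℝ] JetCoord n m r), (∑ k ∈ s, f k).compContinuousLinearMap A =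
        ∑ k ∈ s, (f k).compContinuousLinearMap A := fun s f A =>
    map_sum (ContinuousAlternatingMap.compContinuousLinearMapCLM A) f s
  refine (map_add (ContinuousAlternatingMap.compContinuousLinearMapCLM
    (totalLift (-p)).toContinuousLinearMap) _ _).trans ?_
  simp only [ContinuousAlternatingMap.compContinuousLinearMapCLM_apply, hsum,
    wedge_compContinuousLinearMap, dyForm_totalLift_neg]
  refine (add_right_inj _).2 (Finset.sum_congr rfl fun σ _ => Finset.sum_congr rfl fun I hI => ?_)
  rw [extDeriv_omega_totalLift_neg p σ I (Finset.mem_filter.1 hI).2]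

/-! ### Smooth dependence on the point -/

theorem contDiff_totalLift :
    ContDiff ℝ ∞ fun p : JetCoord n m r => (totalLift p).toContinuousLinearMap := by
  have hy : ∀ σ K, ContDiff ℝ ∞ fun p : JetCoord n m r => p.2 σ K := fun σ K => (dy σ K).contDiff
  refine contDiff_clm_apply_iff.2 fun u => ?_
  have h1 : ContDiff ℝ ∞ fun p : JetCoord n m r => fun (σ : Fin m) (J : MultiIndex n (r + 1)) =>
      u.2 σ J +
        if h : Multiset.card J.1 < r then ∑ i, u.1 i * p.2 σ (MultiIndex.cons i ⟨J.1, h⟩) else 0 := by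
    refine contDiff_pi.2 fun σ => contDiff_pi.2 fun J => contDiff_const.add ?_
    by_cases h : Multiset.card J.1 < r
    · simp only [h, dif_pos]
      exact ContDiff.sum fun i _ => contDiff_const.mul (hy σ _)
    · simp only [h, dif_neg, not_false_eq_true]
      exact contDiff_const
  exact contDiff_const.prodMk h1

end Adapted

section FiniteDimensional

variable {E : Type*} [NormedAddCommGroup E] [NormedSpace ℝ E] [FiniteDimensional ℝ E] {q : ℕ}

instance finiteDimensional_continuousMultilinearMap :
    FiniteDimensional ℝ (ContinuousMultilinearMap ℝ (fun _ : Fin q => E) ℝ) :=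
  FiniteDimensional.of_injective
    (ContinuousMultilinearMap.toMultilinearMapLinear :
      ContinuousMultilinearMap ℝ (fun _ : Fin q => E) ℝ →ₗ[ℝ] MultilinearMap ℝ (fun _ : Fin q => E) ℝ)
    ContinuousMultilinearMap.toMultilinearMap_injective

instance finiteDimensional_continuousAlternatingMap : FiniteDimensional ℝ (E [⋀^Fin q]→L[ℝ] ℝ) :=
  FiniteDimensional.of_injective
    (ContinuousAlternatingMap.toContinuousMultilinearMapLinear :
      E [⋀^Fin q]→L[ℝ] ℝ →ₗ[ℝ] ContinuousMultilinearMap ℝ (fun _ : Fin q => E) ℝ)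
    ContinuousAlternatingMap.toContinuousMultilinearMap_injective

/-- Pull-back of forms along linear maps depends smoothly on both arguments. -/
theorem contDiffOn_compContinuousLinearMap {s : Set E} {f : E → E [⋀^Fin q]→L[ℝ] ℝ}
    {T : E → E →L[ℝ] E} (hf : ContDiffOn ℝ ∞ f s) (hT : ContDiff ℝ ∞ T) :
    ContDiffOn ℝ ∞ (fun p => (f p).compContinuousLinearMap (T p)) s := by
  let ι : (E [⋀^Fin q]→L[ℝ] ℝ) →ₗ[ℝ] ContinuousMultilinearMap ℝ (fun _ : Fin q => E) ℝ :=
    ContinuousAlternatingMap.toContinuousMultilinearMapLinear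
  -- a retraction onto alternating maps reduces the claim to multilinear maps
  obtain ⟨κ, hκ⟩ := ι.exists_leftInverse_of_injective
    (LinearMap.ker_eq_bot.2 ContinuousAlternatingMap.toContinuousMultilinearMap_injective)
  have h1 : ContDiffOn ℝ ∞ (fun p => κ ((ι (f p)).compContinuousLinearMap fun _ => T p)) s := by
    refine κ.toContinuousLinearMap.contDiff.comp_contDiffOn ?_
    have h2 : ContDiff ℝ ∞ fun p =>
        ContinuousMultilinearMap.compContinuousLinearMapContinuousMultilinear ℝ
          (fun _ : Fin q => E) (fun _ : Fin q => E) ℝ fun _ => T p :=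
      (ContinuousMultilinearMap.contDiff _).comp (contDiff_pi.2 fun _ => hT)
    exact h2.contDiffOn.clm_apply (ι.toContinuousLinearMap.contDiff.comp_contDiffOn hf)
  refine h1.congr fun p _ => ?_
  exact (LinearMap.congr_fun hκ ((f p).compContinuousLinearMap (T p))).symm

end FiniteDimensional

/-- A linear map has a linear right inverse on its range. -/
theorem exists_rightInverse_on_range {V W : Type*} [AddCommGroup V] [Module ℝ V] [AddCommGroup W]
    [Module ℝ W] (L : V →ₗ[ℝ] W) : ∃ g : W →ₗ[ℝ] V, ∀ v, L (g (L v)) = L v := by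
  obtain ⟨s, hs⟩ := L.rangeRestrict.exists_rightInverse_of_surjective L.range_rangeRestrict
  obtain ⟨g, hg⟩ := s.exists_extend
  refine ⟨g, fun v => ?_⟩
  have h1 : g (L v) = s (L.rangeRestrict v) := LinearMap.congr_fun hg (L.rangeRestrict v)
  rw [h1]
  exact congrArg Subtype.val (LinearMap.congr_fun hs (L.rangeRestrict v))

/-! ### The structure of contact forms -/

section Main

variable {n m r q : ℕ}
  {X : Type*} [TopologicalSpace X] [ChartedSpace (Fin n → ℝ) X]
  [IsManifold 𝓘(ℝ, Fin n → ℝ) ∞ X]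
  {Y : Type*} [TopologicalSpace Y] [ChartedSpace ((Fin n → ℝ) × (Fin m → ℝ)) Y]
  [IsManifold 𝓘(ℝ, (Fin n → ℝ) × (Fin m → ℝ)) ∞ Y]
  {π : Y → X}

theorem AdaptedChart.HasContactExpression.isContact {c : AdaptedChart n m π} {hq : 2 ≤ q}
    {ρ : CoordForm n m r q} (h : c.HasContactExpression hq ρ) : c.IsContact ρ := by
  obtain ⟨Φ, Ψ, -, -, h⟩ := h
  intro γ x hx hc
  set p := c.prolong r γ (c.base x) with hp
  have h1 := contactSum_totalLift_neg hq p
    (fun σ J => (Φ σ J p).compContinuousLinearMap (totalLift p).toContinuousLinearMap,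
      fun σ J => (Ψ σ J p).compContinuousLinearMap (totalLift p).toContinuousLinearMap)
  have h2 : ∀ {l : ℕ} (α : (JetCoord n m r) [⋀^Fin l]→L[ℝ] ℝ),
      (α.compContinuousLinearMap (totalLift p).toContinuousLinearMap).compContinuousLinearMap
        (totalLift (-p)).toContinuousLinearMap = α := by
    intro l α
    ext v
    change α (_ ∘ _ ∘ v) = α v
    congr 1
    funext i
    exact DFunLike.congr_fun (totalLift_comp_neg p) (v i)
  simp only [h2] at h1
  rw [AdaptedChart.pullback, c.fderiv_prolong γ (c.mem_sectionDomain γ hx hc), ← hp,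
    h p (c.prolong_mem_jetTarget γ hx hc), ← h1]
  have h3 := contactSum_integralElement hq
    (fun σ J => (Φ σ J p).compContinuousLinearMap (totalLift p).toContinuousLinearMap,
      fun σ J => (Ψ σ J p).compContinuousLinearMap (totalLift p).toContinuousLinearMap)
    (fun σ K => partialDeriv K (c.component γ σ) (c.base x))
  refine Eq.trans ?_ h3
  ext v
  change contactSum n m r hq _ (_ ∘ _ ∘ v) = contactSum n m r hq _ (_ ∘ v)
  congr 1
  funext i
  exact DFunLike.congr_fun (totalLift_neg_comp p) _

/-- At each point of the chart, a contact form vanishes on all integral elements, after the adapted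
isomorphism at that point. -/
theorem AdaptedChart.IsContact.comp_integralElement {c : AdaptedChart n m π}
    {ρ : CoordForm n m r q} (h : c.IsContact ρ) {p : JetCoord n m r} (hp : p ∈ c.jetTarget r)
    (a : Fin m → Multiset (Fin n) → ℝ) :
    ((ρ p).compContinuousLinearMap
      (totalLift p).toContinuousLinearMap).compContinuousLinearMap
        (integralElement r a).toContinuousLinearMap = 0 := by
  obtain ⟨γ, x, hx, hc, hbase, hpr, ha⟩ := c.exists_section hp a
  have h1 := h γ x hx hc
  rw [AdaptedChart.pullback, c.fderiv_prolong γ (c.mem_sectionDomain γ hx hc), hbase, hpr] at h1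
  have h2 : integralElement r (fun σ K => partialDeriv K (c.component γ σ) p.1) =
      integralElement r a := by
    refine LinearMap.ext fun v => Prod.ext rfl (funext fun σ => funext fun J => ?_)
    simp only [integralElement_apply]
    refine if_ctx_congr Iff.rfl (fun hJ => Finset.sum_congr rfl fun i _ => ?_) fun _ => rfl
    rw [ha σ _ (by rw [Multiset.card_cons, hJ])]
  rw [h2] at h1
  exact h1

/-- A constant right inverse of `contactSum` on its range turns the pointwise decompositions into
smooth coefficient forms. -/
theorem AdaptedChart.IsContact.hasContactExpression {c : AdaptedChart n m π} (hq : 2 ≤ q)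
    (hqn : q ≤ n) {ρ : CoordForm n m r q} (hρ : c.IsSmooth ρ) (h : c.IsContact ρ) :
    c.HasContactExpression hq ρ := by
  obtain ⟨g, hg⟩ := exists_rightInverse_on_range (contactSum n m r hq)
  let α : CoordForm n m r q := fun p =>
    (ρ p).compContinuousLinearMap (totalLift p).toContinuousLinearMap
  have hα : ContDiffOn ℝ ∞ α (c.jetTarget r) :=
    contDiffOn_compContinuousLinearMap hρ contDiff_totalLift
  have hgα : ContDiffOn ℝ ∞ (fun p => g (α p)) (c.jetTarget r) :=
    g.toContinuousLinearMap.contDiff.comp_contDiffOn hα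
  have hneg : ContDiff ℝ ∞ fun p : JetCoord n m r => (totalLift (-p)).toContinuousLinearMap :=
    contDiff_totalLift.comp contDiff_neg
  refine ⟨fun σ J p => ((g (α p)).1 σ J).compContinuousLinearMap
      (totalLift (-p)).toContinuousLinearMap,
    fun σ J p => ((g (α p)).2 σ J).compContinuousLinearMap
      (totalLift (-p)).toContinuousLinearMap,
    fun σ J => contDiffOn_compContinuousLinearMap ?_ hneg,
    fun σ J => contDiffOn_compContinuousLinearMap ?_ hneg, fun p hp => ?_⟩
  · exact contDiffOn_pi.1 (contDiffOn_pi.1 (contDiff_fst.comp_contDiffOn hgα) σ) J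
  · exact contDiffOn_pi.1 (contDiffOn_pi.1 (contDiff_snd.comp_contDiffOn hgα) σ) J
  · obtain ⟨Θ, hΘ⟩ := exists_contactSum_eq hq hqn (ρ := α p) (h.comp_integralElement hp)
    have h1 : contactSum n m r hq (g (α p)) = α p := by rw [← hΘ, hg]
    rw [← contactSum_totalLift_neg hq p, h1]
    ext v
    change ρ p v = ρ p (_ ∘ _ ∘ v)
    congr 1
    funext i
    exact (DFunLike.congr_fun (totalLift_comp_neg p) (v i)).symm

end Main

end JetContact

end

theorem mainTheorem3 {n m r q : ℕ} (hq : 2 ≤ q) (hqn : q ≤ n)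
    {X : Type*} [TopologicalSpace X] [ChartedSpace (Fin n → ℝ) X]
    [IsManifold 𝓘(ℝ, Fin n → ℝ) ∞ X]
    {Y : Type*} [TopologicalSpace Y] [ChartedSpace ((Fin n → ℝ) × (Fin m → ℝ)) Y]
    [IsManifold 𝓘(ℝ, (Fin n → ℝ) × (Fin m → ℝ)) ∞ Y]
    {F : Type*} [TopologicalSpace F] [ChartedSpace (Fin m → ℝ) F]
    [IsManifold 𝓘(ℝ, Fin m → ℝ) ∞ F]
    (π : Y → X) (hπ : JetContact.IsSmoothFibreBundle n m F π) :
    (∀ (c : JetContact.AdaptedChart n m π) (ρ : JetContact.CoordForm n m r q), c.IsSmooth ρ →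
      (c.IsContact ρ ↔ c.HasContactExpression hq ρ)) ∧
    (∀ ρ : JetContact.JetForm n m π r q,
      ρ.IsContact ↔ ∀ c : JetContact.AdaptedChart n m π, c.HasContactExpression hq (ρ.rep c)) := by
  have ha : ∀ (c : JetContact.AdaptedChart n m π) (ρ : JetContact.CoordForm n m r q),
      c.IsSmooth ρ → (c.IsContact ρ ↔ c.HasContactExpression hq ρ) := fun c ρ hρ =>
    ⟨fun h => h.hasContactExpression hq hqn hρ, fun h => h.isContact⟩
  refine ⟨ha, fun ρ => ⟨fun h c => (ha c _ (ρ.smooth c)).1 fun γ x hx hc => h γ x hx c hc,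
    fun h γ x hx c hc => (ha c _ (ρ.smooth c)).2 (h c) γ x hx hc⟩⟩
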